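/- **Setting.** An instance consists of $n$ buyers, two items with $k$ copies each, and, for every buyer $i$, a known atomless distribution (with finite means) of a vector $v_i=(v_{i1},v_{i2})\in\mathbb{R}_{\ge 0}^2$ of item values; the vectors $v_1,\dots,v_n$ are independent. Buyers are unit-demand: a set $S$ of items is worth $v_i(S)=\max_{j\in S}v_{ij}$ to buyer $i$ (and $v_i(\emptyset)=0$). The prophet's reward is the expectation of the hindsight optimum, i.e. of the maximum of $\sum_i v_i(S_i)$ over all allocations $(S_i)_i$ of sets of items that use at most $k$ copies of each item. A static pricing fixes prices $p_1,p_2\ge 0$. After the values are drawn, an adversary who knows the prices and the values picks the order of arrival; each arriving buyer purchases a set $S$ of items still in stock that maximizes $v_i(S)-\sum_{j\in S}p_j$ (ties may be broken in any way, even so as to maximize welfare). The welfare of $p$ is the expectation of $\sum_i v_i(S_i)$ for the welfare-minimizing order, and the competitive ratio of $p$ on the instance is its welfare divided by the prophet's reward. **Theorem.** Fix an integer $k\ge 1$. For a rate $\lambda\in[0,\infty)$ let $$\hat\mu_k(\lambda)=\frac{\mathbb{E}[\min\{\mathrm{Pois}(\lambda),2k\}]}{2k},\qquad \hat\delta_k(\lambda)=\sum_{i=0}^{2k-1}\Pr[\mathrm{Pois}(\lambda)=i]\cdot\Pr[\mathrm{Binom}(i,1/2)<k].$$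 The equation $\hat\mu_k(\lambda)=\hat\delta_k(\lambda)$ has a unique root $\hat\lambda^*_k$ in $[0,\infty)$. If $k\ge 2$, the equation $\frac{d}{d\lambda}\hat\mu_k(\lambda)+\frac{d}{d\lambda}\hat\delta_k(\lambda)=0$ has a unique root $\hat\lambda'_k$ in $[0,\infty)$; if $k=1$, every $\lambda\ge 0$ is a root, and $\hat\lambda'_1$ denotes an arbitrary one. Let $$\hat\tau_k=\tfrac12\Big(\hat\mu_k\big(\max\{\hat\lambda^*_k,\hat\lambda'_k\}\big)+\hat\delta_k\big(\max\{\hat\lambda^*_k,\hat\lambda'_k\}\big)\Big).$$ Then for every $\epsilon>0$ there is an instance with two items, $k$ copies of each item and unit-demand buyers, with positive prophet's reward, on which every static pricing has competitive ratio at most $\hat\tau_k+\epsilon$. -/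

import Mathlib

open MeasureTheory ProbabilityTheory
open scoped NNReal

noncomputable section

namespace ItemPricing

/-! ## The Poisson and binomial functions -/

/-- The point `1/2` of the unit interval. -/
def oneHalf : unitInterval := ⟨1 / 2, by norm_num, by norm_num⟩

/-- `E[min {Pois(x), 2k}] / (2k)`, for a rate `x ≥ 0`. -/
def muHat (k : ℕ) (x : ℝ) : ℝ :=
  (∫ i : ℕ, ((min i (2 * k) : ℕ) : ℝ) ∂(poissonMeasure x.toNNReal)) / (2 * (k : ℝ))

/-- `∑_{i < 2k} P[Pois(x) = i] * P[Binom(i, 1/2) < k]`, for a rate `x ≥ 0`. -/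
def deltaHat (k : ℕ) (x : ℝ) : ℝ :=
  ∑ i ∈ Finset.range (2 * k),
    (poissonMeasure x.toNNReal).real {i} * (ProbabilityTheory.binomial i oneHalf).real (Set.Iio k)

/-- `x` is a rate at which `muHat` and `deltaHat` agree. -/
def IsCrossing (k : ℕ) (x : ℝ) : Prop :=
  0 ≤ x ∧ muHat k x = deltaHat k x

/-- `x` is a rate at which the derivatives of `muHat` and `deltaHat` add up to zero. Both are
functions on `[0, ∞)`, so the derivative at `0` is one-sided. -/
def IsStationary (k : ℕ) (x : ℝ) : Prop :=
  0 ≤ x ∧ derivWithin (muHat k) (Set.Ici 0) x + derivWithin (deltaHat k) (Set.Ici 0) x = 0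

/-- The mean of `muHat` and `deltaHat` at the larger of the two rates. -/
def tauHat (k : ℕ) (xCross xStat : ℝ) : ℝ :=
  (muHat k (max xCross xStat) + deltaHat k (max xCross xStat)) / 2

/-! ## Multi-unit combinatorial auctions -/

section Auction

variable {n m : ℕ}

/-- The unit-demand valuation with item values `w`: a set is worth its best item. -/
def unitDemand (w : Fin m → ℝ≥0) (S : Finset (Fin m)) : ℝ≥0 := S.sup w

/-- The hindsight optimal welfare of the valuation profile `v` with supply `K`: the maximum over
all allocations of a set of items to every buyer that hand out at most `K j` copies of item `j`. -/
def hindsightOpt (K : Fin m → ℕ) (v : Fin n → Finset (Fin m) → ℝ≥0) : ℝ≥0 :=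
  (Finset.univ.filter fun A : Fin n → Finset (Fin m) =>
    ∀ j, (Finset.univ.filter fun i => j ∈ A i).card ≤ K j).sup fun A => ∑ i, v i (A i)

/-- The quasi-linear utility of a set of items at item prices `p`. -/
def utility (u : Finset (Fin m) → ℝ≥0) (p : Fin m → ℝ≥0) (S : Finset (Fin m)) : ℝ :=
  (u S : ℝ) - ∑ j ∈ S, (p j : ℝ)

/-- The items of which at least one copy is left when the remaining supply is `R`. -/
def available (R : Fin m → ℕ) : Finset (Fin m) := Finset.univ.filter fun j => 0 < R j

open Classical in
/-- The utility-maximizing sets of available items. -/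
def demand (u : Finset (Fin m) → ℝ≥0) (p : Fin m → ℝ≥0) (R : Fin m → ℕ) :
    Finset (Finset (Fin m)) :=
  (available R).powerset.filter fun S => ∀ T ∈ (available R).powerset, utility u p T ≤ utility u p S

/-- The remaining supply after one copy of every item of `S` has been sold. -/
def sell (R : Fin m → ℕ) (S : Finset (Fin m)) (j : Fin m) : ℕ := if j ∈ S then R j - 1 else R j

/-- The social welfare of the static item pricing `p` when the listed buyers arrive in this order
and the supply is `R`. Every buyer purchases a utility-maximizing set of available items; if she
has several, ties are broken so as to maximize the social welfare, so this is an upper bound on the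
welfare of `p` under any other tie-breaking rule. -/
def runWelfare (v : Fin n → Finset (Fin m) → ℝ≥0) (p : Fin m → ℝ≥0) :
    List (Fin n) → (Fin m → ℕ) → ℝ≥0
  | [], _ => 0
  | i :: l, R => (demand (v i) p R).sup fun S => v i S + runWelfare v p l (sell R S)

/-- The welfare of the static item pricing `p` on the valuation profile `v` when the adversary,
knowing `p` and `v`, chooses the worst order of arrival. -/
def worstOrderWelfare (K : Fin m → ℕ) (v : Fin n → Finset (Fin m) → ℝ≥0) (p : Fin m → ℝ≥0) : ℝ≥0 :=
  Finset.univ.inf' Finset.univ_nonempty fun σ : Equiv.Perm (Fin n) =>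
    runWelfare v p (List.ofFn σ) K

end Auction

/-- An instance with `m` items and unit-demand buyers: a number of buyers, the number of copies of
every item, and for every buyer an atomless distribution, with finite means, of the vector of her
item values. The buyers' value vectors are independent. -/
structure Instance (m : ℕ) where
  buyers : ℕ
  supply : Fin m → ℕ
  dist : Fin buyers → Measure (Fin m → ℝ≥0)
  isProb : ∀ i, IsProbabilityMeasure (dist i)
  atomless : ∀ i, NullSingletonClass (dist i)
  integrable : ∀ i j, Integrable (fun w : Fin m → ℝ≥0 => (w j : ℝ)) (dist i)

namespace Instance

variable {m : ℕ}

/-- The joint distribution of the value vectors of all buyers. -/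
def joint (I : Instance m) : Measure (Fin I.buyers → Fin m → ℝ≥0) := Measure.pi I.dist

/-- The expected hindsight optimum. -/
def prophet (I : Instance m) : ℝ :=
  ∫ w, (hindsightOpt I.supply (fun i => unitDemand (w i)) : ℝ) ∂I.joint

/-- The expected social welfare of the static item pricing `p`. -/
def welfare (I : Instance m) (p : Fin m → ℝ≥0) : ℝ :=
  ∫ w, (worstOrderWelfare I.supply (fun i => unitDemand (w i)) p : ℝ) ∂I.joint

end Instance

end ItemPricing

end

noncomputable section

namespace ItemPricing

/-! ## The one-dimensional optimization -/

/-! The hard instance has many small buyers, to whom either item is worth about `1`, and one big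
buyer, who with a tiny probability `ρ` each wants item `0` or item `1` at a value of about `M`,
where `ρ * M = c`. The prophet earns about `2 * k + 2 * c`. The adversary lets the small buyers come
first, so the prices only govern how many small buyers buy and which item they prefer. Let `A` and
`B` of them prefer the two items. If `A + B < 2 * k`, they contribute about `A + B`, and a big buyer
for an item is served only if fewer than `k` small buyers prefer that item. If `A + B ≥ 2 * k`, the
adversary can nearly always keep the total down to about `2 * k`. With `θ = k / (k + c)` the
competitive ratio is thus essentially at most the mean of `payoff`, whose three pieces carry the
weights `θ`, `(1 - θ) / 2` and `(1 - θ) / 2` (`exists_adversary_bounds`, `welfare_hardDist_le`).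

The counts `(A, B)` are trinomial. Given the total, a fair split between the items is best
(`binCdf_add_flip_le`), and for many buyers the total may be treated as Poisson, uniformly in its
mean (`exists_binomialHead_le`). So the ratio is asymptotically at most the maximum over `x` of
`mixHat k θ x`.

The delicate case is `A + B ≥ 2 * k` with small buyers who accept just one item. The values of a
small buyer for the two items differ by at most `η`, while their common noise has the much larger
scale `δ`. If the price gap lies outside `[0, η]`, all small buyers prefer the same item; if it lies
inside, hardly any buyer accepts exactly one item (`exists_small_response_set`). When all prefer the
same item, the adversary can either sell out both items or hold the small sales to `k`. The latter
leaves a total of `k + c`, which is at most `2 * k` only if `c ≤ k`; this is why `θ ≥ 1 / 2` is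
required.

It remains to choose `θ` (`exists_weight`). The slopes of `muHat` and `deltaHat` are `P[Pois(x) < 2
* k]` times `1 / (2 * k)` and times `-meanDrop k x`. As `meanDrop` is increasing, every mixture is
unimodal, and `θ` can be chosen to put its peak at the larger of the two rates. This rate is at
least the stationary one, which gives `θ ≥ 1 / 2`. The peak value is `tauHat`, because either the
two curves meet there or `θ = 1 / 2`. -/

/-- The probability that at most `k - 1` of `i` fair coins show heads. -/
def coinCdf (k i : ℕ) : ℝ := (∑ a ∈ Finset.range k, (i.choose a : ℝ)) / 2 ^ i

lemma sum_range_choose_succ (k i : ℕ) :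
    ∑ a ∈ Finset.range (k + 1), ((i + 1).choose a : ℝ) =
      2 * ∑ a ∈ Finset.range (k + 1), (i.choose a : ℝ) - i.choose k := by
  induction k with
  | zero => norm_num
  | succ k ih =>
    rw [Finset.sum_range_succ, ih, Finset.sum_range_succ _ (k + 1), Nat.choose_succ_succ]
    push_cast
    ring

/-- One more coin destroys the event "fewer than `k` heads" exactly when there were `k - 1` heads
before and the new coin shows heads. -/
lemma coinCdf_sub_succ {k : ℕ} (hk : 1 ≤ k) (i : ℕ) :
    coinCdf k i - coinCdf k (i + 1) = (i.choose (k - 1) : ℝ) / 2 ^ (i + 1) := by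
  obtain ⟨k, rfl⟩ : ∃ l, k = l + 1 := ⟨k - 1, by omega⟩
  simp only [coinCdf, sum_range_choose_succ, Nat.add_sub_cancel]
  field_simp
  ring

/-- Among `2 * k - 1` coins exactly one of heads and tails occurs fewer than `k` times, and the two
are equally likely. -/
lemma coinCdf_two_mul_sub_one {k : ℕ} (hk : 1 ≤ k) : coinCdf k (2 * k - 1) = 1 / 2 := by
  obtain ⟨k, rfl⟩ : ∃ l, k = l + 1 := ⟨k - 1, by omega⟩
  have h : ∑ a ∈ Finset.range (k + 1), ((2 * k + 1).choose a : ℝ) = 4 ^ k := by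
    exact_mod_cast Nat.sum_range_choose_halfway k
  rw [coinCdf, show 2 * (k + 1) - 1 = 2 * k + 1 by omega, h, pow_succ, pow_mul]
  norm_num
  field_simp

lemma coinCdf_zero {k : ℕ} (hk : 1 ≤ k) : coinCdf k 0 = 1 := by
  obtain ⟨k, rfl⟩ : ∃ l, k = l + 1 := ⟨k - 1, by omega⟩
  simp [coinCdf, Finset.sum_range_succ']

lemma binomial_oneHalf_real_Iio (k i : ℕ) :
    (ProbabilityTheory.binomial i oneHalf).real (Set.Iio k) = coinCdf k i := by
  have h : (Set.Iio k : Set ℕ) = (Finset.range k : Finset ℕ) := by ext; simp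
  rw [h, ← sum_measureReal_singleton, coinCdf, Finset.sum_div]
  refine Finset.sum_congr rfl fun a _ => ?_
  rw [binomial_real_singleton]
  have h1 : ((oneHalf : unitInterval) : ℝ) = 1 / 2 := rfl
  rw [h1]
  rcases le_or_gt a i with h | h
  · rw [mul_assoc, show (1 : ℝ) - 1 / 2 = 1 / 2 by norm_num, ← pow_add, Nat.add_sub_cancel' h]
    simp [div_eq_mul_inv]
  · simp [Nat.choose_eq_zero_of_lt h]

/-! ### Poisson sums, their derivatives, and the drops of the survival probability. -/

/-- `∑ i < K, P[Pois(x) = i] * a i`. -/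
def poissonSum (K : ℕ) (a : ℕ → ℝ) (x : ℝ) : ℝ :=
  ∑ i ∈ Finset.range K, Real.exp (-x) * (x ^ i / i.factorial) * a i

/-- Passing to the shortfall `2 * k - min i (2 * k)`, which vanishes from `2 * k` on, turns the
infinite expectation into a finite sum. -/
lemma muHat_eq {k : ℕ} (hk : 1 ≤ k) {x : ℝ} (hx : 0 ≤ x) :
    muHat k x = 1 - poissonSum (2 * k) (fun i => 1 - i / (2 * k)) x := by
  have hk0 : (0 : ℝ) < k := by exact_mod_cast hk
  have hint : Integrable (fun i : ℕ => ((2 * k - min i (2 * k) : ℕ) : ℝ))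
      (poissonMeasure x.toNNReal) := by
    refine Integrable.of_bound (C := 2 * k) .of_discrete (.of_forall fun i => ?_)
    rw [Real.norm_of_nonneg (by positivity)]
    exact_mod_cast Nat.sub_le _ _
  have h1 : ∫ i : ℕ, ((min i (2 * k) : ℕ) : ℝ) ∂(poissonMeasure x.toNNReal) =
      2 * k - ∫ i : ℕ, ((2 * k - min i (2 * k) : ℕ) : ℝ) ∂(poissonMeasure x.toNNReal) := by
    have : (fun i : ℕ => ((min i (2 * k) : ℕ) : ℝ)) =
        fun i : ℕ => (2 * k : ℝ) - ((2 * k - min i (2 * k) : ℕ) : ℝ) := by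
      funext i
      rw [Nat.cast_sub (min_le_right _ _)]
      push_cast
      ring
    rw [this, integral_sub (integrable_const _) hint]
    simp
  rw [muHat, h1, integral_poissonMeasure, tsum_eq_sum (s := Finset.range (2 * k)), poissonSum,
    sub_div, div_self (by positivity), Finset.sum_div]
  · congr 1
    refine Finset.sum_congr rfl fun i hi => ?_
    have hi := Finset.mem_range.1 hi
    rw [min_eq_left hi.le, Nat.cast_sub hi.le, Real.coe_toNNReal _ hx, smul_eq_mul]
    push_cast
    field_simp
  · intro i hi
    have hi := Finset.mem_range.not.1 hi
    rw [min_eq_right (by omega)]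
    simp

lemma deltaHat_eq (k : ℕ) {x : ℝ} (hx : 0 ≤ x) :
    deltaHat k x = poissonSum (2 * k) (coinCdf k) x := by
  refine Finset.sum_congr rfl fun i _ => ?_
  rw [binomial_oneHalf_real_Iio, poissonMeasure_real_singleton, Real.coe_toNNReal _ hx]
  ring

/-- The derivative in the rate of the Poisson mean of `a` is the mean of the forward difference of
`a`. Truncation at `K` amounts to extending `a` by `0`, which accounts for the last difference. -/
lemma hasDerivAt_poissonSum (K : ℕ) (a : ℕ → ℝ) (x : ℝ) :
    HasDerivAt (poissonSum K a)
      (poissonSum K (fun i => (if i + 1 < K then a (i + 1) else 0) - a i) x) x := by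
  have hexp : HasDerivAt (fun x : ℝ => Real.exp (-x)) (-Real.exp (-x)) x := by
    simpa using (hasDerivAt_neg x).exp
  have hterm : ∀ i : ℕ, HasDerivAt (fun x : ℝ => Real.exp (-x) * (x ^ i / i.factorial) * a i)
      ((Real.exp (-x) * (i * x ^ (i - 1) / i.factorial)
        - Real.exp (-x) * (x ^ i / i.factorial)) * a i) x := fun i => by
    convert! (hexp.mul ((hasDerivAt_pow i x).div_const (i.factorial : ℝ))).mul_const (a i) using 1
    ring
  have hsum := HasDerivAt.fun_sum (u := Finset.range K) fun i _ => hterm i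
  refine hsum.congr_deriv ?_
  simp only [poissonSum, sub_mul, mul_sub, Finset.sum_sub_distrib]
  congr 1
  cases K with
  | zero => simp
  | succ K =>
    rw [Finset.sum_range_succ', Finset.sum_range_succ]
    simp only [Nat.cast_zero, zero_mul, zero_div, mul_zero, add_zero, lt_irrefl, if_false]
    refine Finset.sum_congr rfl fun i hi => ?_
    rw [if_pos (by simpa using hi), Nat.factorial_succ]
    push_cast
    have : (i.factorial : ℝ) ≠ 0 := by positivity
    field_simp

/-- The drop of the survival probability `coinCdf k`, killed at `2 * k`, after `i` arrivals. -/
def drop (k i : ℕ) : ℝ := coinCdf k i - if i + 1 < 2 * k then coinCdf k (i + 1) else 0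

lemma drop_of_lt {k i : ℕ} (hk : 1 ≤ k) (h : i + 1 < 2 * k) :
    drop k i = (i.choose (k - 1) : ℝ) / 2 ^ (i + 1) := by
  rw [drop, if_pos h, coinCdf_sub_succ hk]

lemma drop_last {k : ℕ} (hk : 1 ≤ k) : drop k (2 * k - 1) = 1 / 2 := by
  rw [drop, if_neg (by omega), coinCdf_two_mul_sub_one hk, sub_zero]

lemma drop_zero {k : ℕ} (hk : 2 ≤ k) : drop k 0 = 0 := by
  rw [drop_of_lt (by omega) (by omega), Nat.choose_eq_zero_of_lt (by omega)]
  simp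

lemma drop_one (i : ℕ) (hi : i < 2) : drop 1 i = 1 / 2 := by
  interval_cases i
  · rw [drop_of_lt le_rfl (by norm_num)]; norm_num
  · exact drop_last le_rfl

/-- The ratio of `(i + 1).choose (k - 1)` to `i.choose (k - 1)` is `(i + 1) / (i + 2 - k)`, which is
at least `2` as long as `i + 2 < 2 * k`. The last drop, `1 / 2`, comes from the killing at `2 * k`
and dominates its predecessor because a binomial coefficient is at most `2 ^ i`. -/
lemma drop_le_succ {k i : ℕ} (hk : 1 ≤ k) (h : i + 1 < 2 * k) : drop k i ≤ drop k (i + 1) := by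
  rw [drop_of_lt hk h]
  rcases Nat.lt_or_ge (i + 2) (2 * k) with h2 | h2
  · rw [drop_of_lt hk h2, pow_succ _ (i + 1), mul_comm _ (2 : ℝ), ← div_div]
    gcongr
    rw [le_div_iff₀ (by norm_num)]
    rcases Nat.lt_or_ge i (k - 1) with h3 | h3
    · simp [Nat.choose_eq_zero_of_lt h3]
    · have h4 := Nat.add_one_mul_choose_eq i (i - (k - 1))
      have h5 : (i + 1).choose (i - (k - 1) + 1) = (i + 1).choose (k - 1) := by
        rw [← Nat.choose_symm (by omega : i - (k - 1) + 1 ≤ i + 1)]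
        congr 1
        omega
      rw [Nat.choose_symm h3, h5] at h4
      have h6 : 2 * (i - (k - 1) + 1) ≤ i + 1 := by omega
      have h7 : i.choose (k - 1) * 2 ≤ (i + 1).choose (k - 1) := by
        refine Nat.le_of_mul_le_mul_right (c := i - (k - 1) + 1) ?_ (by omega)
        calc i.choose (k - 1) * 2 * (i - (k - 1) + 1)
            = i.choose (k - 1) * (2 * (i - (k - 1) + 1)) := by ring
          _ ≤ i.choose (k - 1) * (i + 1) := Nat.mul_le_mul_left _ h6
          _ = (i + 1).choose (k - 1) * (i - (k - 1) + 1) := by rw [mul_comm, h4]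
      exact_mod_cast h7
  · rw [show i + 1 = 2 * k - 1 by omega, drop_last hk, show 2 * k - 1 = i + 1 by omega,
      pow_succ, ← div_div]
    gcongr
    rw [div_le_one (by positivity)]
    exact_mod_cast Nat.choose_le_two_pow i (k - 1)

lemma drop_mono {k i j : ℕ} (hk : 1 ≤ k) (hij : i ≤ j) (hj : j < 2 * k) : drop k i ≤ drop k j := by
  induction j, hij using Nat.le_induction with
  | base => exact le_rfl
  | succ j _ ih => exact (ih (by omega)).trans (drop_le_succ hk hj)

lemma drop_nonneg {k i : ℕ} (hk : 1 ≤ k) (hi : i < 2 * k) : 0 ≤ drop k i := by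
  refine le_trans ?_ (drop_mono hk (Nat.zero_le i) hi)
  rw [drop_of_lt hk (by omega)]
  positivity

/-! ### Truncated Poisson laws grow with the rate. -/

/-- `∑ i < K, a i * x ^ i / i!`. -/
def expSum (K : ℕ) (a : ℕ → ℝ) (x : ℝ) : ℝ :=
  ∑ i ∈ Finset.range K, x ^ i / i.factorial * a i

lemma poissonSum_eq (K : ℕ) (a : ℕ → ℝ) (x : ℝ) :
    poissonSum K a x = Real.exp (-x) * expSum K a x := by
  simp only [poissonSum, expSum, Finset.mul_sum, mul_assoc]

lemma expSum_one_pos {K : ℕ} (hK : 0 < K) {x : ℝ} (hx : 0 ≤ x) : 0 < expSum K 1 x := by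
  refine Finset.sum_pos' (fun i _ => ?_) ⟨0, Finset.mem_range.2 hK, by simp⟩
  simp only [Pi.one_apply]
  positivity

/-- Symmetrization in `i` and `j`, as in Chebyshev's sum inequality. For monotone `a` both factors
of a summand have the same sign, so means of `a` under the truncated Poisson law increase with the
rate. -/
lemma two_mul_expSum_cross (K : ℕ) (a : ℕ → ℝ) (x y : ℝ) :
    2 * (expSum K a y * expSum K 1 x - expSum K a x * expSum K 1 y) =
      ∑ i ∈ Finset.range K, ∑ j ∈ Finset.range K,
        (a i - a j) * (y ^ i * x ^ j - x ^ i * y ^ j) / (i.factorial * j.factorial) := by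
  have h1 : ∀ u v : ℝ, expSum K a u * expSum K 1 v = ∑ i ∈ Finset.range K, ∑ j ∈ Finset.range K,
      a i * (u ^ i * v ^ j) / (i.factorial * j.factorial) := fun u v => by
    simp only [expSum, Finset.sum_mul_sum, Pi.one_apply]
    refine Finset.sum_congr rfl fun i _ => Finset.sum_congr rfl fun j _ => ?_
    field_simp
  have h2 : ∀ u v : ℝ, expSum K a u * expSum K 1 v = ∑ i ∈ Finset.range K, ∑ j ∈ Finset.range K,
      a j * (v ^ i * u ^ j) / (i.factorial * j.factorial) := fun u v => by
    rw [h1, Finset.sum_comm]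
    refine Finset.sum_congr rfl fun i _ => Finset.sum_congr rfl fun j _ => ?_
    ring
  rw [two_mul]
  nth_rewrite 1 [h1 y x]
  nth_rewrite 1 [h1 x y]
  rw [h2 y x, h2 x y]
  simp only [← Finset.sum_sub_distrib, ← Finset.sum_add_distrib]
  refine Finset.sum_congr rfl fun i _ => Finset.sum_congr rfl fun j _ => ?_
  ring

lemma cross_term_nonneg {K : ℕ} {a : ℕ → ℝ} (ha : ∀ i j, i ≤ j → j < K → a i ≤ a j)
    {x y : ℝ} (hx : 0 ≤ x) (hxy : x ≤ y) {i j : ℕ} (hi : i < K) (hj : j < K) :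
    0 ≤ (a i - a j) * (y ^ i * x ^ j - x ^ i * y ^ j) / (i.factorial * j.factorial) := by
  have key : ∀ i j : ℕ, i ≤ j → x ^ j * y ^ i ≤ x ^ i * y ^ j := fun i j hij => by
    obtain ⟨d, rfl⟩ := Nat.exists_eq_add_of_le hij
    have : x ^ d ≤ y ^ d := by gcongr
    have hy := hx.trans hxy
    calc x ^ (i + d) * y ^ i = x ^ i * y ^ i * x ^ d := by ring
      _ ≤ x ^ i * y ^ i * y ^ d := by gcongr
      _ = _ := by ring
  refine div_nonneg ?_ (by positivity)
  rcases le_total i j with h | h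
  · exact mul_nonneg_of_nonpos_of_nonpos (by linarith [ha i j h hj]) (by linarith [key i j h])
  · exact mul_nonneg (by linarith [ha j i h hi]) (by linarith [key j i h])

lemma expSum_cross_le {K : ℕ} {a : ℕ → ℝ} (ha : ∀ i j, i ≤ j → j < K → a i ≤ a j)
    {x y : ℝ} (hx : 0 ≤ x) (hxy : x ≤ y) :
    expSum K a x * expSum K 1 y ≤ expSum K a y * expSum K 1 x := by
  have h := two_mul_expSum_cross K a x y
  have : 0 ≤ ∑ i ∈ Finset.range K, ∑ j ∈ Finset.range K,
        (a i - a j) * (y ^ i * x ^ j - x ^ i * y ^ j) / (i.factorial * j.factorial) :=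
    Finset.sum_nonneg fun i hi => Finset.sum_nonneg fun j hj =>
      cross_term_nonneg ha hx hxy (Finset.mem_range.1 hi) (Finset.mem_range.1 hj)
  linarith

lemma expSum_cross_lt {K : ℕ} {a : ℕ → ℝ} (ha : ∀ i j, i ≤ j → j < K → a i ≤ a j)
    (hK : 1 < K) (ha' : a 0 < a (K - 1)) {x y : ℝ} (hx : 0 ≤ x) (hxy : x < y) :
    expSum K a x * expSum K 1 y < expSum K a y * expSum K 1 x := by
  have h := two_mul_expSum_cross K a x y
  have : 0 < ∑ i ∈ Finset.range K, ∑ j ∈ Finset.range K,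
        (a i - a j) * (y ^ i * x ^ j - x ^ i * y ^ j) / (i.factorial * j.factorial) := by
    have hnn : ∀ i ∈ Finset.range K, ∀ j ∈ Finset.range K, 0 ≤
        (a i - a j) * (y ^ i * x ^ j - x ^ i * y ^ j) / (i.factorial * j.factorial) :=
      fun i hi j hj =>
        cross_term_nonneg ha hx hxy.le (Finset.mem_range.1 hi) (Finset.mem_range.1 hj)
    -- The pair `(K - 1, 0)` already gives a strictly positive term.
    refine Finset.sum_pos' (fun i hi => Finset.sum_nonneg (hnn i hi))
      ⟨K - 1, Finset.mem_range.2 (by omega), Finset.sum_pos' (hnn _ (Finset.mem_range.2 (by omega)))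
        ⟨0, Finset.mem_range.2 (by omega), ?_⟩⟩
    have : x ^ (K - 1) < y ^ (K - 1) := pow_lt_pow_left₀ hxy hx (by omega)
    refine div_pos (mul_pos (by linarith) ?_) (by positivity)
    simpa using this
  linarith

/-- The mean of `drop k` under the law of `Pois(x)` conditioned to be below `2 * k`. -/
def meanDrop (k : ℕ) (x : ℝ) : ℝ := expSum (2 * k) (drop k) x / expSum (2 * k) 1 x

lemma meanDrop_mono {k : ℕ} (hk : 1 ≤ k) {x y : ℝ} (hx : 0 ≤ x) (hxy : x ≤ y) :
    meanDrop k x ≤ meanDrop k y := by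
  rw [meanDrop, meanDrop, div_le_div_iff₀ (expSum_one_pos (by omega) hx)
    (expSum_one_pos (by omega) (hx.trans hxy))]
  exact expSum_cross_le (fun i j => drop_mono hk) hx hxy

lemma meanDrop_strictMono {k : ℕ} (hk : 2 ≤ k) {x y : ℝ} (hx : 0 ≤ x) (hxy : x < y) :
    meanDrop k x < meanDrop k y := by
  rw [meanDrop, meanDrop, div_lt_div_iff₀ (expSum_one_pos (by omega) hx)
    (expSum_one_pos (by omega) (hx.trans hxy.le))]
  refine expSum_cross_lt (fun i j => drop_mono (by omega)) (by omega) ?_ hx hxy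
  rw [drop_zero hk, drop_last (by omega)]
  norm_num

/-- For `k = 1` both drops equal `1 / 2`, so the mean drop is constantly `1 / (2 * k)` and every
rate is stationary. -/
lemma meanDrop_one {x : ℝ} (hx : 0 ≤ x) : meanDrop 1 x = 1 / 2 := by
  have h := expSum_one_pos (K := 2 * 1) (by norm_num) hx
  rw [meanDrop, div_eq_iff h.ne', expSum, expSum, Finset.mul_sum]
  refine Finset.sum_congr rfl fun i hi => ?_
  rw [drop_one i (by simpa using hi), Pi.one_apply]
  ring

/-! ### Slopes of the two curves and of their mixtures. -/

lemma hasDerivWithinAt_muHat {k : ℕ} (hk : 1 ≤ k) {x : ℝ} (hx : 0 ≤ x) :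
    HasDerivWithinAt (muHat k) (Real.exp (-x) * expSum (2 * k) 1 x * (1 / (2 * k)))
      (Set.Ici 0) x := by
  have hk0 : (0 : ℝ) < k := by exact_mod_cast hk
  have h := ((hasDerivAt_poissonSum (2 * k) (fun i => 1 - i / (2 * k)) x).const_sub
    1).hasDerivWithinAt (s := Set.Ici 0)
  refine (h.congr (fun y hy => muHat_eq hk hy) (muHat_eq hk hx)).congr_deriv ?_
  rw [← poissonSum_eq, poissonSum, poissonSum, Finset.sum_mul, ← Finset.sum_neg_distrib]
  refine Finset.sum_congr rfl fun i hi => ?_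
  have hi := Finset.mem_range.1 hi
  split_ifs with h1
  · simp only [Pi.one_apply]
    push_cast
    field_simp
    ring
  · have : (i : ℝ) = 2 * k - 1 := by
      rw [eq_sub_iff_add_eq]
      exact_mod_cast (by omega : i + 1 = 2 * k)
    rw [this]
    simp only [Pi.one_apply]
    field_simp
    ring

lemma hasDerivWithinAt_deltaHat {k : ℕ} (hk : 1 ≤ k) {x : ℝ} (hx : 0 ≤ x) :
    HasDerivWithinAt (deltaHat k) (-(Real.exp (-x) * expSum (2 * k) 1 x * meanDrop k x))
      (Set.Ici 0) x := by
  have h := (hasDerivAt_poissonSum (2 * k) (coinCdf k) x).hasDerivWithinAt (s := Set.Ici 0)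
  refine (h.congr (fun y hy => deltaHat_eq k hy) (deltaHat_eq k hx)).congr_deriv ?_
  rw [meanDrop, mul_assoc, mul_div_cancel₀ _ (expSum_one_pos (by omega) hx).ne', ← poissonSum_eq,
    poissonSum, poissonSum, ← Finset.sum_neg_distrib]
  refine Finset.sum_congr rfl fun i _ => ?_
  rw [drop]
  ring

/-- Both slopes share the positive factor `P[Pois(x) < 2 * k]`, which cancels. -/
lemma isStationary_iff {k : ℕ} (hk : 1 ≤ k) (x : ℝ) :
    IsStationary k x ↔ 0 ≤ x ∧ meanDrop k x = 1 / (2 * k) := by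
  refine and_congr_right fun hx => ?_
  have hu : UniqueDiffWithinAt ℝ (Set.Ici (0 : ℝ)) x := uniqueDiffOn_Ici 0 x hx
  rw [(hasDerivWithinAt_muHat hk hx).derivWithin hu, (hasDerivWithinAt_deltaHat hk hx).derivWithin hu,
    ← sub_eq_add_neg, ← mul_sub, mul_eq_zero_iff_left, sub_eq_zero, eq_comm]
  exact (mul_pos (Real.exp_pos _) (expSum_one_pos (by omega) hx)).ne'

/-- The mixture of `muHat` and `deltaHat` with weight `θ` on `muHat`. -/
def mixHat (k : ℕ) (θ x : ℝ) : ℝ := θ * muHat k x + (1 - θ) * deltaHat k x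

lemma hasDerivWithinAt_mixHat {k : ℕ} (hk : 1 ≤ k) (θ : ℝ) {x : ℝ} (hx : 0 ≤ x) :
    HasDerivWithinAt (mixHat k θ) (Real.exp (-x) * expSum (2 * k) 1 x *
      (θ * (1 / (2 * k)) - (1 - θ) * meanDrop k x)) (Set.Ici 0) x := by
  refine (((hasDerivWithinAt_muHat hk hx).const_mul θ).add
    ((hasDerivWithinAt_deltaHat hk hx).const_mul (1 - θ))).congr_deriv ?_
  ring

/-- The slope of the mixture is a nonnegative factor times `(1 - θ) * (meanDrop k m - meanDrop k
y)`. Monotonicity of `meanDrop` makes the mixture rise up to `m` and fall afterwards. -/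
lemma mixHat_le {k : ℕ} (hk : 1 ≤ k) {θ m : ℝ} (hθ : θ ≤ 1) (hm : 0 ≤ m)
    (h : θ * (1 / (2 * k)) = (1 - θ) * meanDrop k m) {x : ℝ} (hx : 0 ≤ x) :
    mixHat k θ x ≤ mixHat k θ m := by
  have hcont : ContinuousOn (mixHat k θ) (Set.Ici 0) :=
    fun y hy => (hasDerivWithinAt_mixHat hk θ hy).continuousWithinAt
  have hpos : ∀ y : ℝ, 0 ≤ y → 0 ≤ Real.exp (-y) * expSum (2 * k) 1 y := fun y hy =>
    (mul_pos (Real.exp_pos _) (expSum_one_pos (by omega) hy)).le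
  have hderiv : ∀ y : ℝ, 0 < y → HasDerivAt (mixHat k θ) (Real.exp (-y) * expSum (2 * k) 1 y *
      (θ * (1 / (2 * k)) - (1 - θ) * meanDrop k y)) y := fun y hy =>
    (hasDerivWithinAt_mixHat hk θ hy.le).hasDerivAt (Ici_mem_nhds hy)
  rcases le_total x m with hxm | hxm
  · refine monotoneOn_of_deriv_nonneg (convex_Icc 0 m) (hcont.mono Set.Icc_subset_Ici_self) ?_ ?_
      ⟨hx, hxm⟩ ⟨hm, le_rfl⟩ hxm
    · intro y hy
      rw [interior_Icc] at hy
      exact (hderiv y hy.1).differentiableAt.differentiableWithinAt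
    · intro y hy
      rw [interior_Icc] at hy
      rw [(hderiv y hy.1).deriv, h, ← mul_sub]
      exact mul_nonneg (hpos y hy.1.le) (mul_nonneg (by linarith)
        (sub_nonneg.2 (meanDrop_mono hk hy.1.le hy.2.le)))
  · refine antitoneOn_of_deriv_nonpos (convex_Ici m)
      (hcont.mono (Set.Ici_subset_Ici.2 hm)) ?_ ?_ Set.self_mem_Ici hxm hxm
    · intro y hy
      rw [interior_Ici] at hy
      exact (hderiv y (hm.trans_lt hy)).differentiableAt.differentiableWithinAt
    · intro y hy
      rw [interior_Ici] at hy
      rw [(hderiv y (hm.trans_lt hy)).deriv, h, ← mul_sub]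
      exact mul_nonpos_of_nonneg_of_nonpos (hpos y (hm.trans hy.le))
        (mul_nonpos_of_nonneg_of_nonpos (by linarith)
          (sub_nonpos.2 (meanDrop_mono hk hm (Set.mem_Ioi.1 hy).le)))

/-! ### Existence and uniqueness of the two rates. -/

lemma tendsto_poissonSum_atTop (K : ℕ) (a : ℕ → ℝ) :
    Filter.Tendsto (poissonSum K a) Filter.atTop (nhds 0) := by
  have h : ∀ i ∈ Finset.range K, Filter.Tendsto
      (fun x : ℝ => Real.exp (-x) * (x ^ i / i.factorial) * a i) Filter.atTop (nhds 0) :=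
    fun i _ => by
      have := (Real.tendsto_pow_mul_exp_neg_atTop_nhds_zero i).mul_const (a i / i.factorial)
      rw [zero_mul] at this
      refine this.congr fun x => ?_
      ring
  unfold poissonSum
  simpa using tendsto_finsetSum _ h

/-- The difference of the two curves is strictly increasing, is `-1` at rate `0`, and tends to `1`.
-/
lemma existsUnique_isCrossing {k : ℕ} (hk : 1 ≤ k) : ∃! x : ℝ, IsCrossing k x := by
  set F : ℝ → ℝ := fun x => muHat k x - deltaHat k x with hF
  have hFd : ∀ x, 0 ≤ x → HasDerivWithinAt F (Real.exp (-x) * expSum (2 * k) 1 x *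
      (1 / (2 * k) + meanDrop k x)) (Set.Ici 0) x := fun x hx => by
    refine ((hasDerivWithinAt_muHat hk hx).sub (hasDerivWithinAt_deltaHat hk hx)).congr_deriv ?_
    ring
  have hFc : ContinuousOn F (Set.Ici 0) := fun x hx => (hFd x hx).continuousWithinAt
  have hFmono : StrictMonoOn F (Set.Ici 0) := by
    refine strictMonoOn_of_deriv_pos (convex_Ici 0) hFc fun x hx => ?_
    rw [interior_Ici] at hx
    have hx : 0 < x := hx
    rw [((hFd x hx.le).hasDerivAt (Ici_mem_nhds hx)).deriv]
    have h1 := expSum_one_pos (K := 2 * k) (by omega) hx.le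
    have h2 : 0 ≤ meanDrop k x := div_nonneg (Finset.sum_nonneg fun i hi =>
      mul_nonneg (by positivity) (drop_nonneg hk (Finset.mem_range.1 hi))) h1.le
    have hk0 : (0 : ℝ) < k := by exact_mod_cast hk
    positivity
  have h0 : F 0 ≤ 0 := by
    have hz : ∀ a : ℕ → ℝ, poissonSum (2 * k) a 0 = a 0 := fun a => by
      rw [poissonSum, Finset.sum_eq_single 0]
      · simp
      · intro i _ hi
        simp [hi]
      · intro h
        exact absurd (Finset.mem_range.2 (by omega)) h
    simp [hF, muHat_eq hk le_rfl, deltaHat_eq k le_rfl, hz, coinCdf_zero hk]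
  have hlim : Filter.Tendsto F Filter.atTop (nhds 1) := by
    have h := ((tendsto_poissonSum_atTop (2 * k) (fun i => 1 - i / (2 * k))).const_sub 1).sub
      (tendsto_poissonSum_atTop (2 * k) (coinCdf k))
    rw [sub_zero, sub_zero] at h
    refine h.congr' ?_
    filter_upwards [Filter.eventually_ge_atTop 0] with x hx
    rw [hF]
    simp only [muHat_eq hk hx, deltaHat_eq k hx]
  obtain ⟨y, hy, hy0⟩ := ((hlim.eventually (lt_mem_nhds zero_lt_one)).and
    (Filter.eventually_ge_atTop 0)).exists
  obtain ⟨x, hx, hx0⟩ := intermediate_value_Icc hy0 (hFc.mono Set.Icc_subset_Ici_self)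
    ⟨h0, hy.le⟩
  refine ⟨x, ⟨hx.1, sub_eq_zero.1 hx0⟩, fun z hz => ?_⟩
  exact hFmono.injOn hz.1 hx.1 ((sub_eq_zero.2 hz.2).trans hx0.symm)

lemma continuousOn_meanDrop {k : ℕ} (hk : 1 ≤ k) : ContinuousOn (meanDrop k) (Set.Ici 0) := by
  have h : ∀ a : ℕ → ℝ, Continuous (expSum (2 * k) a) := fun a => by
    unfold expSum
    fun_prop
  exact (h _).continuousOn.div (h _).continuousOn fun x hx => (expSum_one_pos (by omega) hx).ne'

/-- For `k ≥ 2` the mean drop eventually exceeds `1 / (2 * k)`, as its limit is `1 / 2`. -/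
lemma exists_lt_meanDrop {k : ℕ} (hk : 2 ≤ k) : ∃ y : ℝ, 0 ≤ y ∧ 1 / (2 * k) ≤ meanDrop k y := by
  have hk0 : (2 : ℝ) ≤ k := by exact_mod_cast hk
  obtain ⟨K, hK⟩ : ∃ K, 2 * k = K + 1 := ⟨2 * k - 1, by omega⟩
  have hlast : drop k K = 1 / 2 := by
    rw [show K = 2 * k - 1 by omega]
    exact drop_last (by omega)
  -- So large that the top term `y ^ K / K!` outweighs the `K` lower ones together. As the last drop
  -- is `1 / 2`, the mean drop at `y` is then at least `1 / 4`, hence at least `1 / (2 * k)`.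
  set y : ℝ := 2 * K * K.factorial + 1 with hy
  have hy1 : 1 ≤ y := by
    have : (0 : ℝ) ≤ 2 * K * K.factorial := by positivity
    linarith
  refine ⟨y, by linarith, ?_⟩
  have hE := expSum_one_pos (K := 2 * k) (by omega) (by linarith : 0 ≤ y)
  rw [meanDrop, le_div_iff₀ hE]
  have hsmall : ∑ i ∈ Finset.range K, y ^ i / i.factorial ≤ y ^ K / K.factorial := by
    have hKpos : 0 < K := by omega
    calc ∑ i ∈ Finset.range K, y ^ i / i.factorial ≤ ∑ i ∈ Finset.range K, y ^ (K - 1) := by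
          refine Finset.sum_le_sum fun i hi => ?_
          have hi := Finset.mem_range.1 hi
          calc y ^ i / i.factorial ≤ y ^ i :=
                div_le_self (by positivity) (by exact_mod_cast Nat.factorial_pos i)
            _ ≤ y ^ (K - 1) := pow_le_pow_right₀ hy1 (by omega)
      _ = K * y ^ (K - 1) := by simp
      _ ≤ y * y ^ (K - 1) / K.factorial := by
          rw [le_div_iff₀ (by positivity), mul_right_comm]
          gcongr
          have : (0 : ℝ) ≤ K * K.factorial := by positivity
          linarith
      _ = y ^ K / K.factorial := by rw [← pow_succ', Nat.sub_add_cancel hKpos]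
  have h1 : expSum (2 * k) 1 y ≤ 2 * (y ^ K / K.factorial) := by
    rw [expSum, hK, Finset.sum_range_succ]
    simp only [Pi.one_apply, mul_one]
    linarith
  have h2 : y ^ K / K.factorial * (1 / 2) ≤ expSum (2 * k) (drop k) y := by
    rw [expSum, hK, Finset.sum_range_succ, hlast]
    refine le_add_of_nonneg_left (Finset.sum_nonneg fun i hi => ?_)
    have hi := Finset.mem_range.1 hi
    exact mul_nonneg (by positivity) (drop_nonneg (by omega) (by omega))
  have h3 : (1 : ℝ) / (2 * k) ≤ 1 / 4 := by
    gcongr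
    linarith
  calc 1 / (2 * k) * expSum (2 * k) 1 y ≤ 1 / 4 * (2 * (y ^ K / K.factorial)) := by gcongr
    _ = y ^ K / K.factorial * (1 / 2) := by ring
    _ ≤ _ := h2

lemma existsUnique_isStationary {k : ℕ} (hk : 2 ≤ k) : ∃! x : ℝ, IsStationary k x := by
  have hk1 : 1 ≤ k := by omega
  obtain ⟨y, hy0, hy⟩ := exists_lt_meanDrop hk
  have h0 : meanDrop k 0 ≤ 1 / (2 * k) := by
    have : expSum (2 * k) (drop k) 0 = 0 := by
      refine Finset.sum_eq_zero fun i _ => ?_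
      rcases Nat.eq_zero_or_pos i with rfl | hi
      · rw [drop_zero hk, mul_zero]
      · simp [hi.ne']
    rw [meanDrop, this, zero_div]
    positivity
  obtain ⟨x, hx, hxe⟩ := intermediate_value_Icc hy0
    ((continuousOn_meanDrop hk1).mono Set.Icc_subset_Ici_self) ⟨h0, hy⟩
  refine ⟨x, (isStationary_iff hk1 x).2 ⟨hx.1, hxe⟩, fun z hz => ?_⟩
  obtain ⟨hz0, hz⟩ := (isStationary_iff hk1 z).1 hz
  rcases lt_trichotomy z x with h | h | h
  · exact absurd (meanDrop_strictMono hk hz0 h) (by rw [hz, hxe]; exact lt_irrefl _)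
  · exact h
  · exact absurd (meanDrop_strictMono hk hx.1 h) (by rw [hz, hxe]; exact lt_irrefl _)

lemma isStationary_one {x : ℝ} (hx : 0 ≤ x) : IsStationary 1 x := by
  rw [isStationary_iff le_rfl]
  exact ⟨hx, by rw [meanDrop_one hx]; norm_num⟩

/-- The weight for which `tauHat` is the largest value of the mixture of `muHat` and
`deltaHat`. -/
lemma exists_weight {k : ℕ} (hk : 1 ≤ k) {xCross xStat : ℝ} (hc : IsCrossing k xCross)
    (hs : IsStationary k xStat) :
    ∃ θ : ℝ, 1 / 2 ≤ θ ∧ θ < 1 ∧ ∀ x, 0 ≤ x → mixHat k θ x ≤ tauHat k xCross xStat := by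
  have hk0 : (0 : ℝ) < k := by exact_mod_cast hk
  obtain ⟨hs0, hs⟩ := (isStationary_iff hk xStat).1 hs
  set m := max xCross xStat with hm
  have hm0 : 0 ≤ m := hs0.trans (le_max_right _ _)
  set ρ := meanDrop k m with hρ
  set u : ℝ := 1 / (2 * k) with hu
  have hu0 : 0 < u := by positivity
  have hρu : u ≤ ρ := hs ▸ meanDrop_mono hk hs0 (le_max_right _ _)
  have hsum : 0 < u + ρ := by linarith
  -- This weight solves the first-order condition `θ * u = (1 - θ) * ρ` at `m`; it is at least `1 /
  -- 2` because `u ≤ ρ`.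
  refine ⟨ρ / (u + ρ), ?_, ?_, fun x hx => ?_⟩
  · rw [div_le_div_iff₀ (by norm_num) hsum]
    linarith
  · rw [div_lt_one hsum]
    linarith
  · have hθ : ρ / (u + ρ) * (1 / (2 * k)) = (1 - ρ / (u + ρ)) * meanDrop k m := by
      rw [← hu, ← hρ]
      field_simp
      ring
    refine (mixHat_le hk (by rw [div_le_one hsum]; linarith) hm0 hθ hx).trans_eq ?_
    rw [tauHat, ← hm, mixHat]
    -- At the stationary rate the weight is `1 / 2`, so the mixture is the plain average; at the
    -- crossing all mixtures have the same value.
    rcases le_total xCross xStat with h | h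
    · have : ρ = u := by rw [hρ, hm, max_eq_right h, hs]
      rw [this]
      field_simp
      ring
    · have : muHat k m = deltaHat k m := by rw [hm, max_eq_left h, hc.2]
      rw [this]
      ring

/-! ## Multinomial counts -/

/-- `E[f(X, n - X)]` for `X ~ Binom(n, x)` when `y = 1 - x`. -/
def binSum (x y : ℝ) (n : ℕ) (f : ℕ → ℕ → ℝ) : ℝ :=
  ∑ ij ∈ Finset.HasAntidiagonal.antidiagonal n, (n.choose ij.1 : ℝ) * (x ^ ij.1 * y ^ ij.2 * f ij.1 ij.2)

lemma binSum_zero (x y : ℝ) (f : ℕ → ℕ → ℝ) : binSum x y 0 f = f 0 0 := by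
  simp [binSum]

lemma binSum_succ (x y : ℝ) (n : ℕ) (f : ℕ → ℕ → ℝ) :
    binSum x y (n + 1) f =
      x * binSum x y n (fun i j => f (i + 1) j) + y * binSum x y n (fun i j => f i (j + 1)) := by
  rw [binSum, Finset.sum_antidiagonal_choose_succ_mul (fun i j => x ^ i * y ^ j * f i j), add_comm,
    binSum, binSum, Finset.mul_sum, Finset.mul_sum]
  congr 1
  · refine Finset.sum_congr rfl fun ij hij => ?_
    rw [← Nat.choose_symm_of_eq_add (Finset.HasAntidiagonal.mem_antidiagonal.1 hij).symm]
    ring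
  · refine Finset.sum_congr rfl fun ij _ => ?_
    ring

lemma binSum_const {x y : ℝ} (h : x + y = 1) (n : ℕ) (c : ℝ) :
    binSum x y n (fun _ _ => c) = c := by
  induction n with
  | zero => rw [binSum_zero]
  | succ n ih => rw [binSum_succ, ih, ← add_mul, h, one_mul]

lemma binSum_congr {x y : ℝ} {n : ℕ} {f g : ℕ → ℕ → ℝ} (h : ∀ i j, i + j = n → f i j = g i j) :
    binSum x y n f = binSum x y n g :=
  Finset.sum_congr rfl fun ij hij => by rw [h _ _ (Finset.HasAntidiagonal.mem_antidiagonal.1 hij)]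

lemma binSum_le {x y : ℝ} (hx : 0 ≤ x) (hy : 0 ≤ y) {n : ℕ} {f g : ℕ → ℕ → ℝ}
    (h : ∀ i j, i + j = n → f i j ≤ g i j) : binSum x y n f ≤ binSum x y n g :=
  Finset.sum_le_sum fun ij hij => by
    have := h _ _ (Finset.HasAntidiagonal.mem_antidiagonal.1 hij)
    gcongr

lemma binSum_add (x y : ℝ) (n : ℕ) (f g : ℕ → ℕ → ℝ) :
    binSum x y n (fun i j => f i j + g i j) = binSum x y n f + binSum x y n g := by
  simp only [binSum, ← Finset.sum_add_distrib]
  exact Finset.sum_congr rfl fun ij _ => by ring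

lemma binSum_mul (x y : ℝ) (n : ℕ) (c : ℝ) (f : ℕ → ℕ → ℝ) :
    binSum x y n (fun i j => c * f i j) = c * binSum x y n f := by
  simp only [binSum, Finset.mul_sum]
  exact Finset.sum_congr rfl fun ij _ => by ring

lemma binSum_swap (x y : ℝ) (n : ℕ) (f : ℕ → ℕ → ℝ) :
    binSum x y n f = binSum y x n (fun i j => f j i) := by
  rw [binSum, ← Finset.Nat.sum_antidiagonal_swap, binSum]
  refine Finset.sum_congr rfl fun ij hij => ?_
  rw [Prod.fst_swap, Prod.snd_swap, ← Nat.choose_symm_of_eq_add (Finset.HasAntidiagonal.mem_antidiagonal.1 hij).symm]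
  ring

/-- The expectation of `h (a + A) (b + B)`, where `A` and `B` count how many of `n` independent
trials have the first and the second of three outcomes, of probabilities `α`, `β` and
`1 - α - β`. -/
def trinomialExp (α β : ℝ) (h : ℕ → ℕ → ℝ) : ℕ → ℕ → ℕ → ℝ
  | 0, a, b => h a b
  | n + 1, a, b => α * trinomialExp α β h n (a + 1) b + β * trinomialExp α β h n a (b + 1) +
      (1 - α - β) * trinomialExp α β h n a b

/-- A trial can be made in two stages: first decide with probability `p` whether one of the two
counted outcomes occurs, then choose between them with probability `q`. -/
lemma trinomialExp_eq (p q : ℝ) (h : ℕ → ℕ → ℝ) (n a b : ℕ) :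
    trinomialExp (p * q) (p * (1 - q)) h n a b =
      binSum p (1 - p) n (fun i _ => binSum q (1 - q) i fun s t => h (a + s) (b + t)) := by
  induction n generalizing a b with
  | zero => simp [binSum_zero, trinomialExp]
  | succ n ih =>
    rw [trinomialExp, ih, ih, ih, binSum_succ]
    simp only [binSum_succ q, binSum_add, binSum_mul, add_assoc, add_comm 1]
    ring

/-! ### The fair split is the best one -/

/-- The probability that `Binom(i, q) < k`. -/
def binCdf (k i : ℕ) (q : ℝ) : ℝ :=
  ∑ a ∈ Finset.range k, (i.choose a : ℝ) * (q ^ a * (1 - q) ^ (i - a))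

lemma binSum_ite_lt (k i : ℕ) (q : ℝ) :
    binSum q (1 - q) i (fun s _ => if s < k then 1 else 0) = binCdf k i q := by
  rw [binSum, Finset.Nat.sum_antidiagonal_eq_sum_range_succ_mk, binCdf]
  simp only [mul_ite, mul_one, mul_zero]
  rw [← Finset.sum_filter]
  refine Finset.sum_subset_zero_on_sdiff (fun s hs => ?_) (fun s hs => ?_) (fun s _ => rfl)
  · simp only [Finset.mem_filter, Finset.mem_range] at hs ⊢
    exact hs.2
  · simp only [Finset.mem_sdiff, Finset.mem_filter, Finset.mem_range] at hs
    rw [Nat.choose_eq_zero_of_lt (by omega)]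
    simp

lemma binCdf_half (k i : ℕ) : binCdf k i (1 / 2) = coinCdf k i := by
  rw [binCdf, coinCdf, Finset.sum_div]
  refine Finset.sum_congr rfl fun a _ => ?_
  rcases le_or_gt a i with h | h
  · rw [show (1 : ℝ) - 1 / 2 = 1 / 2 by norm_num, ← pow_add, Nat.add_sub_cancel' h]
    simp [div_eq_mul_inv]
  · simp [Nat.choose_eq_zero_of_lt h]

/-- Differentiating term by term in `q` telescopes, so only the boundary term at `k` survives. -/
lemma hasDerivAt_binCdf (k i : ℕ) (q : ℝ) :
    HasDerivAt (binCdf (k + 1) (i + 1)) (-((i + 1) * i.choose k * (q ^ k * (1 - q) ^ (i - k)))) q := by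
  have h1 : ∀ m : ℕ, HasDerivAt (fun x : ℝ => (1 - x) ^ m) (-(m * (1 - q) ^ (m - 1))) q := fun m => by
    convert! ((hasDerivAt_id q).const_sub 1).pow m using 1
    simp
  induction k with
  | zero =>
    have h2 : binCdf (0 + 1) (i + 1) = fun x => (1 - x) ^ (i + 1) := by
      funext x
      simp [binCdf]
    rw [h2]
    refine (h1 _).congr_deriv ?_
    simp
  | succ k ih =>
    have h2 : binCdf (k + 1 + 1) (i + 1) = fun x => binCdf (k + 1) (i + 1) x +
        ((i + 1).choose (k + 1) : ℝ) * (x ^ (k + 1) * (1 - x) ^ (i + 1 - (k + 1))) := by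
      funext x
      simp only [binCdf]
      rw [Finset.sum_range_succ]
    rw [h2]
    refine (ih.add (((hasDerivAt_pow (k + 1) q).mul (h1 _)).const_mul _)).congr_deriv ?_
    have h3 : ((i + 1).choose (k + 1) : ℝ) * (k + 1) = (i + 1) * i.choose k := by
      exact_mod_cast (Nat.add_one_mul_choose_eq i k).symm
    rw [show i + 1 - (k + 1) = i - k by omega]
    rcases Nat.lt_or_ge k i with hki | hki
    · have h4 : ((i + 1).choose (k + 1) : ℝ) * (i - k : ℕ) = (i + 1) * i.choose (k + 1) := by
        have h5 := Nat.choose_succ_right_eq (i + 1) (k + 1)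
        have h6 := Nat.add_one_mul_choose_eq i (k + 1)
        rw [Nat.add_sub_add_right] at h5
        exact_mod_cast h5.symm.trans h6.symm
      rw [show i - k - 1 = i - (k + 1) by omega]
      simp only [Nat.cast_add, Nat.cast_one, Nat.add_sub_cancel]
      linear_combination (q ^ k * (1 - q) ^ (i - k)) * h3 - (q ^ (k + 1) * (1 - q) ^ (i - (k + 1))) * h4
    · rw [Nat.choose_eq_zero_of_lt (by omega : i < k + 1), show i - k = 0 by omega]
      simp only [Nat.cast_add, Nat.cast_one, Nat.add_sub_cancel, Nat.cast_zero]
      linear_combination (q ^ k) * h3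

/-- The left side is symmetric about `q = 1 / 2` and increases up to there, because its derivative
compares `(1 - q) ^ k * q ^ (i - k)` with the same expression at `1 - q` (both indices shifted by
one). -/
lemma binCdf_add_flip_le {k i : ℕ} (hi : i < 2 * k) {q : ℝ} (hq0 : 0 ≤ q) (hq1 : q ≤ 1) :
    binCdf k i q + binCdf k i (1 - q) ≤ 2 * coinCdf k i := by
  obtain ⟨k, rfl⟩ : ∃ l, k = l + 1 := ⟨k - 1, by omega⟩
  rcases Nat.eq_zero_or_pos i with rfl | hi0
  · have h : ∀ q, binCdf (k + 1) 0 q = 1 := fun q => by simp [binCdf, Finset.sum_range_succ']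
    rw [h, h, coinCdf_zero (by omega)]
    norm_num
  obtain ⟨i, rfl⟩ : ∃ l, i = l + 1 := ⟨i - 1, by omega⟩
  wlog hq : q ≤ 1 / 2 generalizing q
  · have := this (q := 1 - q) (by linarith) (by linarith) (by linarith)
    rw [sub_sub_cancel] at this
    linarith
  set F : ℝ → ℝ := fun x => binCdf (k + 1) (i + 1) x + binCdf (k + 1) (i + 1) (1 - x) with hF
  have hd : ∀ x, HasDerivAt F ((i + 1) * i.choose k *
      ((1 - x) ^ k * x ^ (i - k) - x ^ k * (1 - x) ^ (i - k))) x := fun x => by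
    have h1 := (hasDerivAt_binCdf k i (1 - x)).comp x ((hasDerivAt_id x).const_sub 1)
    refine ((hasDerivAt_binCdf k i x).add h1).congr_deriv ?_
    rw [sub_sub_cancel]
    ring
  have hmono : MonotoneOn F (Set.Icc 0 (1 / 2)) := by
    refine monotoneOn_of_deriv_nonneg (convex_Icc _ _)
      (fun x _ => (hd x).continuousAt.continuousWithinAt)
      (fun x _ => (hd x).differentiableAt.differentiableWithinAt) fun x hx => ?_
    rw [interior_Icc] at hx
    obtain ⟨hx0, hx1⟩ := hx
    rw [(hd x).deriv]
    rcases Nat.lt_or_ge i k with hik | hik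
    · rw [Nat.choose_eq_zero_of_lt hik]
      simp
    -- In the shifted indices `i ≤ 2 * k`; this nonnegative surplus exponent is where the hypothesis
    -- `hi` enters.
    · obtain ⟨e, he⟩ : ∃ e, k = (i - k) + e := ⟨k - (i - k), by omega⟩
      refine mul_nonneg (by positivity) (sub_nonneg.2 ?_)
      have h1x : 0 ≤ 1 - x := by linarith
      calc x ^ k * (1 - x) ^ (i - k) = x ^ (i - k) * (1 - x) ^ (i - k) * x ^ e := by
            nth_rewrite 1 [he]; rw [pow_add]; ring
        _ ≤ x ^ (i - k) * (1 - x) ^ (i - k) * (1 - x) ^ e := by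
            gcongr
            linarith
        _ = (1 - x) ^ k * x ^ (i - k) := by
            nth_rewrite 3 [he]; rw [pow_add]; ring
  have := hmono ⟨hq0, hq⟩ ⟨by norm_num, le_rfl⟩ hq
  simp only [hF] at this
  rwa [show (1 : ℝ) - 1 / 2 = 1 / 2 by norm_num, binCdf_half, ← two_mul] at this

/-- The normalized payoff when `a` buyers prefer the first and `b` buyers the second item. -/
def payoff (k : ℕ) (θ : ℝ) (a b : ℕ) : ℝ :=
  if a + b < 2 * k then θ * ((a + b : ℕ) / (2 * k)) +
    (1 - θ) / 2 * ((if a < k then 1 else 0) + (if b < k then 1 else 0)) else θ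

/-- The mean of `payoff` over fair preferences of `i` buyers. -/
def fairPayoff (k : ℕ) (θ : ℝ) (i : ℕ) : ℝ :=
  if i < 2 * k then θ * (i / (2 * k)) + (1 - θ) * coinCdf k i else θ

lemma binSum_payoff_le {k : ℕ} {θ : ℝ} (hθ : θ ≤ 1) (i : ℕ) {q : ℝ} (hq0 : 0 ≤ q) (hq1 : q ≤ 1) :
    binSum q (1 - q) i (payoff k θ) ≤ fairPayoff k θ i := by
  rw [fairPayoff]
  split_ifs with hi
  · have h1 : binSum q (1 - q) i (payoff k θ) = binSum q (1 - q) i (fun s t => θ * (i / (2 * k)) +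
        (1 - θ) / 2 * ((if s < k then 1 else 0) + (if t < k then 1 else 0))) :=
      binSum_congr fun s t hst => by rw [payoff, hst, if_pos hi]
    have h2 : binSum q (1 - q) i (fun _ t => if t < k then 1 else 0) = binCdf k i (1 - q) := by
      rw [binSum_swap, ← binSum_ite_lt, sub_sub_cancel]
    rw [h1, binSum_add, binSum_const (by ring), binSum_mul, binSum_add, binSum_ite_lt, h2]
    have := binCdf_add_flip_le hi hq0 hq1
    nlinarith
  · refine le_of_eq ?_
    refine Eq.trans ?_ (binSum_const (x := q) (y := 1 - q) (by ring) i θ)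
    exact binSum_congr fun s t hst => by rw [payoff, hst, if_neg hi]

/-- Condition on the number of interested buyers: the conditional split is binomial, and a fair one
pays at least as much. -/
lemma trinomialExp_payoff_le {k : ℕ} {θ : ℝ} (hθ : θ ≤ 1) (n : ℕ) {α β : ℝ} (hα : 0 ≤ α)
    (hβ : 0 ≤ β) (hαβ : α + β ≤ 1) :
    trinomialExp α β (payoff k θ) n 0 0 ≤
      binSum (α + β) (1 - (α + β)) n (fun i _ => fairPayoff k θ i) := by
  obtain ⟨q, hq0, hq1, h1, h2⟩ : ∃ q : ℝ, 0 ≤ q ∧ q ≤ 1 ∧ α = (α + β) * q ∧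
      β = (α + β) * (1 - q) := by
    rcases eq_or_lt_of_le (add_nonneg hα hβ) with h | h
    · exact ⟨0, le_rfl, zero_le_one, by linarith, by linarith⟩
    · refine ⟨α / (α + β), by positivity, (div_le_one h).2 (by linarith), ?_, ?_⟩ <;>
        field_simp
      ring
  have h3 := trinomialExp_eq (α + β) q (payoff k θ) n 0 0
  rw [← h1, ← h2] at h3
  rw [h3]
  refine binSum_le (by linarith) (by linarith) fun i _ _ => ?_
  simpa using binSum_payoff_le hθ i hq0 hq1

/-! ### The uniform Poisson limit -/

/-- `∑ i < K, P[Binom(n, p) = i] * G i`. -/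
def binomialHead (K n : ℕ) (p : ℝ) (G : ℕ → ℝ) : ℝ :=
  ∑ i ∈ Finset.range K, n.choose i * p ^ i * (1 - p) ^ (n - i) * G i

/-- Subtracting the eventual constant value leaves a finite sum of fixed length, to which termwise
Poisson limits apply. -/
lemma binSum_eq_head {K n : ℕ} (hKn : K ≤ n) (p : ℝ) {G : ℕ → ℝ} {c : ℝ}
    (hG : ∀ i, K ≤ i → G i = c) :
    binSum p (1 - p) n (fun i _ => G i) = c + binomialHead K n p (fun i => G i - c) := by
  have h1 : binSum p (1 - p) n (fun i _ => G i) =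
      c + binSum p (1 - p) n (fun i _ => G i - c) := by
    rw [← binSum_const (x := p) (y := 1 - p) (by ring) n c, ← binSum_add,
      binSum_const (by ring) n c]
    exact binSum_congr fun i j _ => by ring
  rw [h1, binSum, Finset.Nat.sum_antidiagonal_eq_sum_range_succ_mk, binomialHead]
  congr 1
  refine (Finset.sum_subset_zero_on_sdiff (Finset.range_subset_range.2 (by omega)) (fun i hi => ?_)
    fun i _ => ?_).symm
  · simp only [Finset.mem_sdiff, Finset.mem_range, not_lt] at hi
    simp [hG i hi.2]
  · simp only
    ring

open Filter Topology in
lemma tendsto_binomialHead (K : ℕ) (G : ℕ → ℝ) {φ : ℕ → ℕ} (hφ : StrictMono φ) {q : ℕ → ℝ} {r : ℝ}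
    (h : Tendsto (fun m => φ m * q m) atTop (𝓝 r)) :
    Tendsto (fun m => binomialHead K (φ m) (q m) G) atTop (𝓝 (poissonSum K G r)) := by
  -- The Poisson limit theorem concerns full sequences of parameters, so the gaps of the subsequence
  -- are filled with `r / n`, whose mean is exactly `r`.
  set p : ℕ → ℝ := Function.extend φ q fun n => r / n with hp
  have hpφ : ∀ m, p (φ m) = q m := fun m => hφ.injective.extend_apply _ _ _
  have hlim : Tendsto (fun n : ℕ => n * p n) atTop (𝓝 r) := by
    rw [Metric.tendsto_atTop] at h ⊢
    intro ε hε
    obtain ⟨M, hM⟩ := h ε hε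
    refine ⟨φ M + 1, fun n hn => ?_⟩
    by_cases hex : ∃ m, φ m = n
    · obtain ⟨m, rfl⟩ := hex
      rw [hpφ]
      exact hM m (hφ.le_iff_le.1 (by omega))
    · rw [hp, Function.extend_apply' _ _ _ hex]
      have : (n : ℝ) ≠ 0 := by
        have : n ≠ 0 := by omega
        exact_mod_cast this
      rw [mul_div_cancel₀ _ this, dist_self]
      exact hε
  have hsum : Tendsto (fun n => binomialHead K n (p n) G) atTop (𝓝 (poissonSum K G r)) := by
    refine tendsto_finsetSum _ fun i _ => ?_
    convert! (tendsto_choose_mul_pow_of_tendsto_mul_atTop i hlim).mul_const (G i) using 2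
    ring
  exact (hsum.comp hφ.tendsto_atTop).congr fun m => by simp only [Function.comp, hpφ]

open Filter Topology in
-- The probability of exactly `i` successes is at most `exp i * t ^ i * exp (-t)`, where `t` is the
-- mean, and this vanishes as `t` tends to infinity.
lemma tendsto_binomialHead_zero (K : ℕ) (G : ℕ → ℝ) {φ : ℕ → ℕ} {q : ℕ → ℝ}
    (hq0 : ∀ m, 0 ≤ q m) (hq1 : ∀ m, q m ≤ 1)
    (h : Tendsto (fun m => φ m * q m) atTop atTop) :
    Tendsto (fun m => binomialHead K (φ m) (q m) G) atTop (𝓝 0) := by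
  have hterm : ∀ i ∈ Finset.range K, Tendsto
      (fun m => (φ m).choose i * q m ^ i * (1 - q m) ^ (φ m - i) * G i) atTop (𝓝 0) := fun i _ => by
    rw [← zero_mul (G i)]
    refine Tendsto.mul_const _ ?_
    have hup : Tendsto (fun m => Real.exp i *
        ((φ m * q m) ^ i * Real.exp (-(φ m * q m)))) atTop (𝓝 0) := by
      simpa using ((Real.tendsto_pow_mul_exp_neg_atTop_nhds_zero i).comp h).const_mul (Real.exp i)
    refine squeeze_zero (fun m => ?_) (fun m => ?_) hup
    · have := hq0 m
      have : 0 ≤ 1 - q m := sub_nonneg.2 (hq1 m)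
      positivity
    · have h0 := hq0 m
      have h1 : 0 ≤ 1 - q m := sub_nonneg.2 (hq1 m)
      have h2 : ((φ m).choose i : ℝ) ≤ (φ m : ℝ) ^ i := by exact_mod_cast Nat.choose_le_pow _ _
      have h3 : (1 - q m) ^ (φ m - i) ≤ Real.exp i * Real.exp (-(φ m * q m)) := by
        have h4 : 1 - q m ≤ Real.exp (-q m) := by
          have := Real.add_one_le_exp (-q m)
          linarith
        calc (1 - q m) ^ (φ m - i) ≤ Real.exp (-q m) ^ (φ m - i) := by gcongr
          _ = Real.exp (-((φ m - i : ℕ) * q m)) := by rw [← Real.exp_nat_mul]; ring_nf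
          _ ≤ Real.exp (i + -(φ m * q m)) := by
            refine Real.exp_le_exp.2 ?_
            have h5 : (φ m : ℝ) ≤ (φ m - i : ℕ) + i := by exact_mod_cast le_tsub_add
            have h6 : (i : ℝ) * q m ≤ i := mul_le_of_le_one_right (by positivity) (hq1 m)
            nlinarith
          _ = _ := Real.exp_add _ _
      calc (φ m).choose i * q m ^ i * (1 - q m) ^ (φ m - i)
          ≤ (φ m : ℝ) ^ i * q m ^ i * (Real.exp i * Real.exp (-(φ m * q m))) := by gcongr
        _ = _ := by ring
  simpa [binomialHead] using tendsto_finsetSum _ hterm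

open Filter Topology in
-- Compactness: parameters violating the bound for arbitrarily large `n` have means that either tend
-- to infinity or converge along a subsequence. The head then tends to `0` or to a Poisson sum, and
-- neither exceeds `T`.
lemma exists_binomialHead_le (K : ℕ) (G : ℕ → ℝ) {T : ℝ} (hT : ∀ x, 0 ≤ x → poissonSum K G x ≤ T)
    {ε : ℝ} (hε : 0 < ε) :
    ∃ N, ∀ n, N ≤ n → ∀ p : ℝ, 0 ≤ p → p ≤ 1 → binomialHead K n p G ≤ T + ε := by
  by_contra hcon
  push Not at hcon
  have hfreq : ∃ᶠ n in atTop, ∃ p : ℝ, 0 ≤ p ∧ p ≤ 1 ∧ T + ε < binomialHead K n p G :=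
    frequently_atTop.2 fun N => by
      obtain ⟨n, hn, p, h⟩ := hcon N
      exact ⟨n, hn, p, h⟩
  obtain ⟨φ, hφ, hbad⟩ := extraction_of_frequently_atTop hfreq
  choose q hq0 hq1 hq using hbad
  -- Needed for means escaping to infinity, where the limit of the head is `0`.
  have hT0 : 0 ≤ T := le_of_tendsto (tendsto_poissonSum_atTop K G)
    ((eventually_ge_atTop 0).mono hT)
  by_cases htop : Tendsto (fun m => φ m * q m) atTop atTop
  · have h := le_of_tendsto_of_tendsto' tendsto_const_nhds
      (tendsto_binomialHead_zero K G hq0 hq1 htop) fun m => (hq m).le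
    linarith
  · rw [tendsto_atTop] at htop
    push Not at htop
    obtain ⟨L, hL⟩ := htop
    have hL' : ∃ᶠ m in atTop, φ m * q m ∈ Set.Icc 0 L := by
      refine hL.mono fun m hm => ⟨mul_nonneg (by positivity) (hq0 m), ?_⟩
      linarith
    obtain ⟨r, hr, ψ, hψ, hlim⟩ := tendsto_subseq_of_frequently_bounded (Metric.isBounded_Icc _ _) hL'
    rw [closure_Icc] at hr
    have h := le_of_tendsto_of_tendsto' tendsto_const_nhds
      (tendsto_binomialHead K G (hφ.comp hψ) (q := q ∘ ψ) hlim) fun m => (hq (ψ m)).le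
    linarith [hT r hr.1]

lemma mixHat_eq {k : ℕ} (hk : 1 ≤ k) (θ : ℝ) {x : ℝ} (hx : 0 ≤ x) :
    mixHat k θ x = θ + poissonSum (2 * k) (fun i => fairPayoff k θ i - θ) x := by
  rw [mixHat, muHat_eq hk hx, deltaHat_eq k hx, poissonSum, poissonSum, poissonSum, mul_sub, mul_one,
    sub_add_eq_add_sub, add_sub_assoc, Finset.mul_sum, Finset.mul_sum, ← Finset.sum_sub_distrib]
  congr 1
  refine Finset.sum_congr rfl fun i hi => ?_
  rw [fairPayoff, if_pos (Finset.mem_range.1 hi)]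
  ring

/-- With many trials, the trinomial expectation of `payoff` is essentially at most the supremum
of its Poisson counterpart. -/
lemma exists_trinomialExp_payoff_le {k : ℕ} (hk : 1 ≤ k) {θ T : ℝ} (hθ : θ ≤ 1)
    (hT : ∀ x, 0 ≤ x → mixHat k θ x ≤ T) {ε : ℝ} (hε : 0 < ε) :
    ∃ N, ∀ n, N ≤ n → ∀ α β : ℝ, 0 ≤ α → 0 ≤ β → α + β ≤ 1 →
      trinomialExp α β (payoff k θ) n 0 0 ≤ T + ε := by
  obtain ⟨N, hN⟩ := exists_binomialHead_le (2 * k) (fun i => fairPayoff k θ i - θ) (T := T - θ)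
    (fun x hx => by linarith [hT x hx, mixHat_eq hk θ hx]) hε
  refine ⟨max N (2 * k), fun n hn α β hα hβ hαβ => ?_⟩
  refine (trinomialExp_payoff_le hθ n hα hβ hαβ).trans ?_
  rw [binSum_eq_head (le_of_max_le_right hn) _ (G := fairPayoff k θ) (c := θ)
    fun i hi => if_neg (by omega)]
  linarith [hN n (le_of_max_le_left hn) (α + β) (by linarith) hαβ]

/-! ## Runs of a static pricing -/

section Run

variable {n m : ℕ} {v : Fin n → Finset (Fin m) → ℝ≥0} {p : Fin m → ℝ≥0}

/-- `Run v p l R R' w`: the buyers in `l` can take the supply from `R` to `R'` and collect the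
total value `w`. -/
inductive Run (v : Fin n → Finset (Fin m) → ℝ≥0) (p : Fin m → ℝ≥0) :
    List (Fin n) → (Fin m → ℕ) → (Fin m → ℕ) → ℝ → Prop
  | nil (R : Fin m → ℕ) : Run v p [] R R 0
  | cons {i : Fin n} {l : List (Fin n)} {R R' : Fin m → ℕ} {S : Finset (Fin m)} {w : ℝ}
      (hS : S ∈ demand (v i) p R) (h : Run v p l (sell R S) R' w) :
      Run v p (i :: l) R R' (v i S + w)

lemma mem_demand {u : Finset (Fin m) → ℝ≥0} {R : Fin m → ℕ} {S : Finset (Fin m)} :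
    S ∈ demand u p R ↔ S ⊆ available R ∧ ∀ T ⊆ available R, utility u p T ≤ utility u p S := by
  simp [demand]

lemma demand_nonempty (u : Finset (Fin m) → ℝ≥0) (p : Fin m → ℝ≥0) (R : Fin m → ℕ) :
    (demand u p R).Nonempty := by
  obtain ⟨S, hS, h⟩ := Finset.exists_max_image (available R).powerset (utility u p)
    ⟨∅, Finset.empty_mem_powerset _⟩
  exact ⟨S, mem_demand.2 ⟨Finset.mem_powerset.1 hS, fun T hT => h T (Finset.mem_powerset.2 hT)⟩⟩

lemma pos_of_mem_demand {u : Finset (Fin m) → ℝ≥0} {R : Fin m → ℕ} {S : Finset (Fin m)}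
    (hS : S ∈ demand u p R) {j : Fin m} (hj : j ∈ S) : 0 < R j :=
  (Finset.mem_filter.1 ((mem_demand.1 hS).1 hj)).2

lemma singleton_subset_available {R : Fin m → ℕ} {j : Fin m} (hj : 0 < R j) :
    {j} ⊆ available R :=
  Finset.singleton_subset_iff.2 (Finset.mem_filter.2 ⟨Finset.mem_univ _, hj⟩)

/-- The best tie-breaking is attained, so a bound valid for every run of an order bounds the
worst-order welfare, however ties are broken. -/
lemma exists_run (v : Fin n → Finset (Fin m) → ℝ≥0) (p : Fin m → ℝ≥0) (l : List (Fin n))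
    (R : Fin m → ℕ) : ∃ R', Run v p l R R' (runWelfare v p l R) := by
  induction l generalizing R with
  | nil => exact ⟨R, by simpa [runWelfare] using Run.nil R⟩
  | cons i l ih =>
    obtain ⟨S, hS, h⟩ := Finset.exists_mem_eq_sup (demand (v i) p R) (demand_nonempty _ _ _)
      fun S => v i S + runWelfare v p l (sell R S)
    obtain ⟨R', hR'⟩ := ih (sell R S)
    refine ⟨R', ?_⟩
    rw [runWelfare, h, NNReal.coe_add]
    exact Run.cons hS hR'

/-- Lets the adversary's orders be analysed block by block. -/
lemma Run.append {l₁ l₂ : List (Fin n)} {R R' : Fin m → ℕ} {w : ℝ}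
    (h : Run v p (l₁ ++ l₂) R R' w) :
    ∃ R₁ w₁ w₂, Run v p l₁ R R₁ w₁ ∧ Run v p l₂ R₁ R' w₂ ∧ w = w₁ + w₂ := by
  induction l₁ generalizing R w with
  | nil => exact ⟨R, 0, w, Run.nil R, h, (zero_add w).symm⟩
  | cons i l ih =>
    cases h with
    | cons hS h =>
      obtain ⟨R₁, w₁, w₂, h₁, h₂, rfl⟩ := ih h
      exact ⟨R₁, _, w₂, Run.cons hS h₁, h₂, (add_assoc _ _ _).symm⟩

lemma sell_le (R : Fin m → ℕ) (S : Finset (Fin m)) (j : Fin m) : sell R S j ≤ R j := by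
  rw [sell]
  split_ifs <;> omega

lemma Run.supply_le {l : List (Fin n)} {R R' : Fin m → ℕ} {w : ℝ} (h : Run v p l R R' w)
    (j : Fin m) : R' j ≤ R j := by
  induction h with
  | nil R => exact le_rfl
  | cons _ _ ih => exact ih.trans (sell_le _ _ _)

/-- Buyers who always take item `j` when it is available deplete it. -/
lemma Run.supply_le_sub {l : List (Fin n)} {R R' : Fin m → ℕ} {w : ℝ} (h : Run v p l R R' w)
    {j : Fin m} {P : (Fin m → ℕ) → Prop} (hP : ∀ R S, P R → P (sell R S)) (hR : P R)
    (hl : ∀ i ∈ l, ∀ R, P R → 0 < R j → ∀ S ∈ demand (v i) p R, j ∈ S) :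
    R' j ≤ R j - l.length := by
  induction h with
  | nil R => simp
  | @cons i l R R' S w hS h ih =>
    have h1 := ih (hP _ _ hR) fun i hi => hl i (List.mem_cons_of_mem _ hi)
    have h2 : sell R S j ≤ R j - 1 := by
      rcases Nat.eq_zero_or_pos (R j) with h0 | h0
      · have := sell_le R S j
        omega
      · rw [sell, if_pos (hl i List.mem_cons_self R hR h0 S hS)]
    rw [List.length_cons]
    omega

lemma sum_sell_lt {u : Finset (Fin m) → ℝ≥0} {R : Fin m → ℕ} {S : Finset (Fin m)}
    (hS : S ∈ demand u p R) (hne : S.Nonempty) : ∑ j, sell R S j + 1 ≤ ∑ j, R j := by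
  obtain ⟨j, hj⟩ := hne
  refine Finset.sum_lt_sum (fun j _ => sell_le R S j) ⟨j, Finset.mem_univ _, ?_⟩
  have := pos_of_mem_demand hS hj
  rw [sell, if_pos hj]
  omega

/-- Buyers who take something as long as anything is available deplete the total supply. -/
lemma Run.sum_supply_le_sub {l : List (Fin n)} {R R' : Fin m → ℕ} {w : ℝ} (h : Run v p l R R' w)
    (hl : ∀ i ∈ l, ∀ R : Fin m → ℕ, (∃ j, 0 < R j) → ∀ S ∈ demand (v i) p R, S.Nonempty) :
    ∑ j, R' j ≤ ∑ j, R j - l.length := by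
  induction h with
  | nil R => simp
  | @cons i l R R' S w hS h ih =>
    have h1 := ih fun i hi => hl i (List.mem_cons_of_mem _ hi)
    have h2 : ∑ j, sell R S j ≤ ∑ j, R j - 1 := by
      rcases Nat.eq_zero_or_pos (∑ j, R j) with h0 | h0
      · have : ∑ j, sell R S j ≤ ∑ j, R j := Finset.sum_le_sum fun j _ => sell_le R S j
        omega
      · have hex : ∃ j, 0 < R j := by
          by_contra hcon
          push Not at hcon
          exact h0.ne' (Finset.sum_eq_zero fun j _ => Nat.le_zero.1 (hcon j))
        have := sum_sell_lt hS (hl i List.mem_cons_self R hex S hS)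
        omega
    rw [List.length_cons]
    omega

lemma Run.value_le_sum {l : List (Fin n)} {R R' : Fin m → ℕ} {w : ℝ} (h : Run v p l R R' w)
    {b : Fin n → ℝ} (hl : ∀ i ∈ l, ∀ R, ∀ S ∈ demand (v i) p R, (v i S : ℝ) ≤ b i) :
    w ≤ (l.map b).sum := by
  induction h with
  | nil R => simp
  | @cons i l R R' S w hS h ih =>
    rw [List.map_cons, List.sum_cons]
    exact add_le_add (hl i List.mem_cons_self R S hS)
      (ih fun i hi => hl i (List.mem_cons_of_mem _ hi))

/-- The collected value is bounded by the number of sold copies. -/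
lemma Run.value_add_le {l : List (Fin n)} {R R' : Fin m → ℕ} {w : ℝ} (h : Run v p l R R' w)
    {e : ℝ} (he : 0 ≤ e) (hl : ∀ i ∈ l, v i ∅ = 0 ∧ ∀ S, (v i S : ℝ) ≤ e) :
    w + e * (∑ j, R' j : ℕ) ≤ e * (∑ j, R j : ℕ) := by
  induction h with
  | nil R => simp
  | @cons i l R R' S w hS h ih =>
    have h1 := ih fun i hi => hl i (List.mem_cons_of_mem _ hi)
    obtain ⟨h0, h2⟩ := hl i List.mem_cons_self
    rcases S.eq_empty_or_nonempty with rfl | hne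
    · rw [h0, NNReal.coe_zero, zero_add]
      refine h1.trans ?_
      gcongr
      exact sell_le R ∅ _
    · have h3 : ((∑ j, sell R S j : ℕ) : ℝ) + 1 ≤ (∑ j, R j : ℕ) := by
        exact_mod_cast sum_sell_lt hS hne
      have := h2 S
      nlinarith

/-- The collected value is bounded by the number of sold copies of item `j` when nobody takes
other items only. -/
lemma Run.value_add_le_item {l : List (Fin n)} {R R' : Fin m → ℕ} {w : ℝ} (h : Run v p l R R' w)
    {e : ℝ} (he : 0 ≤ e) {j : Fin m} (hl : ∀ i ∈ l, v i ∅ = 0 ∧ ∀ S, (v i S : ℝ) ≤ e)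
    (hj : ∀ i ∈ l, ∀ R, ∀ S ∈ demand (v i) p R, S = ∅ ∨ j ∈ S) :
    w + e * R' j ≤ e * R j := by
  induction h with
  | nil R => simp
  | @cons i l R R' S w hS h ih =>
    have h1 := ih (fun i hi => hl i (List.mem_cons_of_mem _ hi))
      fun i hi => hj i (List.mem_cons_of_mem _ hi)
    obtain ⟨h0, h2⟩ := hl i List.mem_cons_self
    rcases hj i List.mem_cons_self R S hS with rfl | hjS
    · rw [h0, NNReal.coe_zero, zero_add]
      refine h1.trans ?_
      gcongr
      exact sell_le R ∅ _
    · have h3 : (sell R S j : ℝ) + 1 ≤ R j := by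
        have := pos_of_mem_demand hS hjS
        rw [sell, if_pos hjS]
        exact_mod_cast (by omega : R j - 1 + 1 ≤ R j)
      have := h2 S
      nlinarith

lemma worstOrderWelfare_le (K : Fin m → ℕ) (v : Fin n → Finset (Fin m) → ℝ≥0) (p : Fin m → ℝ≥0)
    {l : List (Fin n)} (hl : l.Nodup) (hmem : ∀ i, i ∈ l) :
    worstOrderWelfare K v p ≤ runWelfare v p l K := by
  have hlen : l.length = n := by
    have h := List.toFinset_card_of_nodup hl
    rw [← h, show l.toFinset = Finset.univ by ext i; simp [hmem], Finset.card_univ, Fintype.card_fin]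
  let g : Fin n → Fin n := fun i => l.get (i.cast hlen.symm)
  have hg : Function.Injective g := fun a b hab => by
    have := (List.nodup_iff_injective_get.1 hl) hab
    exact Fin.cast_injective _ this
  let σ : Equiv.Perm (Fin n) := Equiv.ofBijective g (Finite.injective_iff_bijective.1 hg)
  have hσ : List.ofFn σ = l := by
    refine List.ext_get (by simp [hlen]) fun i h1 h2 => ?_
    simp [σ, g]
  rw [worstOrderWelfare]
  exact (Finset.inf'_le _ (Finset.mem_univ σ)).trans_eq (by rw [hσ])

end Run

/-! ## Unit-demand buyers -/

section UnitDemand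

variable {m : ℕ} {p x : Fin m → ℝ≥0} {R : Fin m → ℕ} {S : Finset (Fin m)}

lemma unitDemand_empty (x : Fin m → ℝ≥0) : unitDemand x ∅ = 0 := by simp [unitDemand]

lemma unitDemand_le {e : ℝ} (he : 0 ≤ e) (hx : ∀ j, (x j : ℝ) ≤ e) (S : Finset (Fin m)) :
    (unitDemand x S : ℝ) ≤ e := by
  lift e to ℝ≥0 using he
  exact NNReal.coe_le_coe.2 (Finset.sup_le fun j _ => NNReal.coe_le_coe.1 (hx j))

lemma unitDemand_le_sum (x : Fin m → ℝ≥0) (S : Finset (Fin m)) :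
    unitDemand x S ≤ ∑ j ∈ S, x j :=
  Finset.sup_le fun _ hj => Finset.single_le_sum (fun _ _ => zero_le) hj

lemma utility_empty (p x : Fin m → ℝ≥0) : utility (unitDemand x) p ∅ = 0 := by
  simp [utility, unitDemand]

lemma utility_singleton (p x : Fin m → ℝ≥0) (j : Fin m) :
    utility (unitDemand x) p {j} = x j - p j := by
  simp [utility, unitDemand]

/-- Since prices are nonnegative, a set is no better than its most valuable item alone. -/
lemma exists_utility_le (p x : Fin m → ℝ≥0) (hS : S.Nonempty) :
    ∃ j ∈ S, utility (unitDemand x) p S ≤ x j - p j := by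
  obtain ⟨j, hj, h⟩ := Finset.exists_mem_eq_sup S hS x
  refine ⟨j, hj, ?_⟩
  rw [utility, unitDemand, h]
  have : (p j : ℝ) ≤ ∑ j ∈ S, (p j : ℝ) :=
    Finset.single_le_sum (f := fun j => (p j : ℝ)) (fun _ _ => NNReal.coe_nonneg _) hj
  linarith

lemma nonempty_of_mem_demand (hS : S ∈ demand (unitDemand x) p R) {j : Fin m} (hj : 0 < R j)
    (hx : p j < x j) : S.Nonempty := by
  rw [Finset.nonempty_iff_ne_empty]
  rintro rfl
  have h := (mem_demand.1 hS).2 {j} (singleton_subset_available hj)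
  rw [utility_singleton, utility_empty] at h
  have : (p j : ℝ) < x j := hx
  linarith

/-- Only membership can be claimed: the demanded set may also contain superfluous items of price
zero. -/
lemma mem_of_prefers (hS : S ∈ demand (unitDemand x) p R) {j : Fin m} (hj : 0 < R j)
    (hx : p j < x j) (hpref : ∀ i, i ≠ j → (x i : ℝ) - p i < x j - p j) : j ∈ S := by
  obtain ⟨i, hi, h⟩ := exists_utility_le p x (nonempty_of_mem_demand hS hj hx)
  have h1 := (mem_demand.1 hS).2 {j} (singleton_subset_available hj)
  rw [utility_singleton] at h1
  by_cases hij : i = j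
  · exact hij ▸ hi
  · linarith [hpref i hij]

lemma mem_of_only_available (hS : S ∈ demand (unitDemand x) p R) {j : Fin m} (hj : 0 < R j)
    (hx : p j < x j) (hR : ∀ i, i ≠ j → R i = 0) : j ∈ S := by
  obtain ⟨i, hi⟩ := nonempty_of_mem_demand hS hj hx
  by_cases hij : i = j
  · exact hij ▸ hi
  · exact absurd (hR i hij) (pos_of_mem_demand hS hi).ne'

lemma exists_acceptable (hS : S ∈ demand (unitDemand x) p R) (hne : S.Nonempty) :
    ∃ j ∈ S, p j ≤ x j := by
  obtain ⟨i, hi, h⟩ := exists_utility_le p x hne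
  have h1 := (mem_demand.1 hS).2 ∅ (Finset.empty_subset _)
  rw [utility_empty] at h1
  exact ⟨i, hi, NNReal.coe_le_coe.1 (by linarith)⟩

end UnitDemand

/-! ## The adversary against two prices -/

/-- How a buyer without ties reacts to two prices: she accepts no item, or she prefers item `j`,
and accepts the other item as well if the flag is set. -/
abbrev Response := Option (Fin 2 × Bool)

/-- The buyer with item values `x` has the given response to the prices `p`. -/
def Responds (p x : Fin 2 → ℝ≥0) : Response → Prop
  | none => ∀ j, x j < p j
  | some (j, both) => p j < x j ∧ ∀ i, i ≠ j →
      ((x i : ℝ) - p i < x j - p j ∧ if both then p i < x i else x i < p i)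

section Adversary

variable {n : ℕ}

/-- The number of buyers who prefer item `j`. -/
def prefCount (κ : Fin n → Response) (j : Fin 2) : ℕ :=
  (Finset.univ.filter fun s => ∃ b, κ s = some (j, b)).card

/-- The number of buyers who prefer item `j` and accept both items. -/
def bothCount (κ : Fin n → Response) (j : Fin 2) : ℕ :=
  (Finset.univ.filter fun s => κ s = some (j, true)).card

/-- Both items are preferred by someone, and some buyer accepts one item only. -/
def Mixed (κ : Fin n → Response) : Prop :=
  (∃ s j, κ s = some (j, false)) ∧ ∀ j, 0 < prefCount κ j

lemma length_filter_finRange (P : Fin n → Prop) [DecidablePred P] :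
    ((List.finRange n).filter P).length = (Finset.univ.filter P).card := by
  rw [← List.toFinset_card_of_nodup ((List.nodup_finRange n).filter _)]
  congr 1
  ext s
  simp

variable {k : ℕ} {p : Fin 2 → ℝ≥0} {x : Fin (n + 1) → Fin 2 → ℝ≥0} {κ : Fin n → Response} {e : ℝ}

/-- Let the small buyers in `l` come first, then the other small buyers, then the big one. -/
lemma exists_runs (K : Fin 2 → ℕ) (x : Fin (n + 1) → Fin 2 → ℝ≥0) (p : Fin 2 → ℝ≥0)
    {l : List (Fin n)} (hl : l.Nodup) :
    ∃ R₁ R₂ R₃ w₁ w₂ w₃, Run (fun i => unitDemand (x i)) p (l.map Fin.succ) K R₁ w₁ ∧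
      Run (fun i => unitDemand (x i)) p
        (((List.finRange n).filter (· ∉ l)).map Fin.succ) R₁ R₂ w₂ ∧
      Run (fun i => unitDemand (x i)) p [0] R₂ R₃ w₃ ∧
      (worstOrderWelfare K (fun i => unitDemand (x i)) p : ℝ) ≤ w₁ + w₂ + w₃ := by
  set v : Fin (n + 1) → Finset (Fin 2) → ℝ≥0 := fun i => unitDemand (x i)
  set l' := (List.finRange n).filter (· ∉ l)
  have hnd : ((l ++ l').map Fin.succ ++ [0]).Nodup := by
    rw [List.nodup_append]
    refine ⟨List.Nodup.map (Fin.succ_injective n) ?_, List.nodup_singleton _, ?_⟩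
    · rw [List.nodup_append]
      refine ⟨hl, (List.nodup_finRange n).filter _, ?_⟩
      rintro a ha b hb rfl
      simp [l', ha] at hb
    · rintro a ha b hb rfl
      obtain ⟨s, -, hs⟩ := List.mem_map.1 ha
      exact Fin.succ_ne_zero s (hs.trans (List.mem_singleton.1 hb))
  have hmem : ∀ i, i ∈ (l ++ l').map Fin.succ ++ [0] := fun i => by
    refine Fin.cases (by simp) (fun s => ?_) i
    simp only [List.map_append, List.mem_append, List.mem_map_of_injective (Fin.succ_injective n)]
    by_cases hs : s ∈ l
    · exact Or.inl (Or.inl hs)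
    · exact Or.inl (Or.inr (by simp [l', hs]))
  have hworst := worstOrderWelfare_le K v p hnd hmem
  obtain ⟨R₃, hrun⟩ := exists_run v p ((l ++ l').map Fin.succ ++ [0]) K
  obtain ⟨R₂, w₁₂, w₃, h₁₂, h₃, hw⟩ := hrun.append
  rw [List.map_append] at h₁₂
  obtain ⟨R₁, w₁, w₂, h₁, h₂, rfl⟩ := h₁₂.append
  exact ⟨R₁, R₂, R₃, w₁, w₂, w₃, h₁, h₂, h₃, hw ▸ NNReal.coe_le_coe.2 hworst⟩

lemma unitDemand_bounds (he : 0 ≤ e) (hx : ∀ s j, (x (Fin.succ s) j : ℝ) ≤ e) (l : List (Fin n)) :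
    ∀ i ∈ l.map Fin.succ, unitDemand (x i) ∅ = 0 ∧ ∀ S, (unitDemand (x i) S : ℝ) ≤ e := by
  intro i hi
  obtain ⟨s, -, rfl⟩ := List.mem_map.1 hi
  exact ⟨unitDemand_empty _, unitDemand_le he (hx s)⟩

lemma big_value_le {R R' : Fin 2 → ℕ} {w : ℝ}
    (h : Run (fun i => unitDemand (x i)) p [0] R R' w) {j : Fin 2} (h0 : ∀ i, i ≠ j → x 0 i = 0) :
    w ≤ if 0 < R j then (x 0 j : ℝ) else 0 := by
  cases h with
  | @cons _ _ _ _ S _ hS h =>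
    cases h with
    | nil =>
      rw [add_zero]
      refine (NNReal.coe_le_coe.2 (unitDemand_le_sum (x 0) S)).trans ?_
      by_cases hj : j ∈ S
      · rw [if_pos (pos_of_mem_demand hS hj), Finset.sum_eq_single_of_mem j hj fun i _ => h0 i]
      · rw [Finset.sum_eq_zero fun i hi => h0 i fun hij => hj (hij ▸ hi)]
        split_ifs <;> simp

lemma big_value_le_sum {R R' : Fin 2 → ℕ} {w : ℝ}
    (h : Run (fun i => unitDemand (x i)) p [0] R R' w) : w ≤ ∑ j, (x 0 j : ℝ) := by
  cases h with
  | @cons _ _ _ _ S _ hS h =>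
    cases h with
    | nil =>
      rw [add_zero]
      refine (NNReal.coe_le_coe.2 (unitDemand_le_sum (x 0) S)).trans ?_
      rw [NNReal.coe_sum]
      exact Finset.sum_le_sum_of_subset_of_nonneg (Finset.subset_univ _) fun _ _ _ =>
        NNReal.coe_nonneg _

/-- If the buyers in `l` can be relied on to sell out item `j`, then a big buyer for item `j` who
comes last gets nothing. -/
lemma worst_le_of_soldOut (he : 0 ≤ e) (hx : ∀ s j, (x (Fin.succ s) j : ℝ) ≤ e) {l : List (Fin n)}
    (hl : l.Nodup) {j : Fin 2} (h0 : ∀ i, i ≠ j → x 0 i = 0)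
    (hout : ∀ R w, Run (fun i => unitDemand (x i)) p (l.map Fin.succ) (fun _ => k) R w → R j = 0) :
    (worstOrderWelfare (fun _ => k) (fun i => unitDemand (x i)) p : ℝ) ≤ 2 * k * e := by
  obtain ⟨R₁, R₂, R₃, w₁, w₂, w₃, h₁, h₂, h₃, hw⟩ := exists_runs (fun _ => k) x p hl
  have e1 := h₁.value_add_le he (unitDemand_bounds he hx _)
  have e2 := h₂.value_add_le he (unitDemand_bounds he hx _)
  have e3 := big_value_le h₃ h0
  have hR : R₂ j = 0 := Nat.le_zero.1 ((h₂.supply_le j).trans (hout _ _ h₁).le)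
  rw [hR, if_neg (lt_irrefl 0)] at e3
  have : (0 : ℝ) ≤ e * (∑ j, R₂ j : ℕ) := by positivity
  rw [Fin.sum_const, smul_eq_mul] at e1
  push_cast at e1 e2 this ⊢
  linarith

/-- At most `2 * k` copies go to small buyers, each for at most `e`, whatever their order. -/
lemma worst_le_add_big (he : 0 ≤ e) (hx : ∀ s j, (x (Fin.succ s) j : ℝ) ≤ e) :
    (worstOrderWelfare (fun _ => k) (fun i => unitDemand (x i)) p : ℝ) ≤
      2 * k * e + ∑ j, (x 0 j : ℝ) := by
  obtain ⟨R₁, R₂, R₃, w₁, w₂, w₃, h₁, h₂, h₃, hw⟩ :=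
    exists_runs (fun _ => k) x p (List.nodup_nil (α := Fin n))
  have e1 := h₁.value_add_le he (unitDemand_bounds he hx _)
  have e2 := h₂.value_add_le he (unitDemand_bounds he hx _)
  have e3 := big_value_le_sum h₃
  have : (0 : ℝ) ≤ e * (∑ j, R₂ j : ℕ) := by positivity
  rw [Fin.sum_const, smul_eq_mul] at e1
  push_cast at e1 e2 this ⊢
  linarith

lemma Responds.eq_empty {p y : Fin 2 → ℝ≥0} (h : Responds p y none) {R : Fin 2 → ℕ}
    {S : Finset (Fin 2)} (hS : S ∈ demand (unitDemand y) p R) : S = ∅ := by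
  by_contra hne
  obtain ⟨j, -, hj⟩ := exists_acceptable hS (Finset.nonempty_iff_ne_empty.2 hne)
  exact (h j).not_ge hj

lemma card_interested (κ : Fin n → Response) :
    (Finset.univ.filter fun s => κ s ≠ none).card = prefCount κ 0 + prefCount κ 1 := by
  rw [prefCount, prefCount, ← Finset.card_union_of_disjoint]
  · congr 1
    ext s
    simp only [Finset.mem_filter, Finset.mem_univ, true_and, Finset.mem_union, ne_eq,
      Option.ne_none_iff_exists', Prod.exists, Fin.exists_fin_two]
  · rw [Finset.disjoint_filter]
    rintro s - ⟨b, hb⟩ ⟨b', hb'⟩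
    rw [hb] at hb'
    simp at hb'

lemma worst_le_interested (he : 0 ≤ e) (hx : ∀ s j, (x (Fin.succ s) j : ℝ) ≤ e)
    (hκ : ∀ s, Responds p (x (Fin.succ s)) (κ s)) :
    (worstOrderWelfare (fun _ => k) (fun i => unitDemand (x i)) p : ℝ) ≤
      e * (prefCount κ 0 + prefCount κ 1 : ℕ) + ∑ j, (x 0 j : ℝ) := by
  obtain ⟨R₁, R₂, R₃, w₁, w₂, w₃, h₁, h₂, h₃, hw⟩ :=
    exists_runs (fun _ => k) x p (List.nodup_finRange n)
  have e3 := big_value_le_sum h₃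
  have e1 : w₁ ≤ e * (prefCount κ 0 + prefCount κ 1 : ℕ) := by
    refine (h₁.value_le_sum (b := Fin.cases 0 fun s => if κ s ≠ none then e else 0)
      fun i hi R S hS => ?_).trans_eq ?_
    · obtain ⟨s, -, rfl⟩ := List.mem_map.1 hi
      simp only [Fin.cases_succ]
      split_ifs with h
      · exact unitDemand_le he (hx s) S
      · have hs := hκ s
        rw [not_not.1 h] at hs
        rw [hs.eq_empty hS, unitDemand_empty, NNReal.coe_zero]
    · rw [List.map_map, ← List.ofFn_eq_map, List.sum_ofFn]
      simp only [Function.comp_apply, Fin.cases_succ]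
      rw [← Finset.sum_filter, Finset.sum_const, card_interested, nsmul_eq_mul, mul_comm]
  have e2 : w₂ ≤ 0 := by
    refine (h₂.value_le_sum (b := fun _ => 0) fun i hi => ?_).trans_eq (by simp)
    simp at hi
  linarith

lemma length_pref (κ : Fin n → Response) (j : Fin 2) :
    ((List.finRange n).filter fun s => ∃ b, κ s = some (j, b)).length = prefCount κ j :=
  length_filter_finRange _

lemma soldOut_of_prefer (hκ : ∀ s, Responds p (x (Fin.succ s)) (κ s)) {j : Fin 2} {l : List (Fin n)}
    (hl : ∀ s ∈ l, ∃ b, κ s = some (j, b)) {R R' : Fin 2 → ℕ} {w : ℝ}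
    (h : Run (fun i => unitDemand (x i)) p (l.map Fin.succ) R R' w) :
    R' j ≤ R j - l.length := by
  have h1 := h.supply_le_sub (P := fun _ => True) (j := j) (fun _ _ _ => trivial) trivial
    fun i hi R _ hR S hS => by
      obtain ⟨s, hs, rfl⟩ := List.mem_map.1 hi
      obtain ⟨b, hb⟩ := hl s hs
      have := hκ s
      rw [hb] at this
      exact mem_of_prefers hS hR this.1 fun i hi => (this.2 i hi).1
  simpa using h1

/-- Such buyers never leave empty-handed while anything is in stock, so only the total supply
matters, not which item each of them takes. -/
lemma soldOut_of_both (hκ : ∀ s, Responds p (x (Fin.succ s)) (κ s)) {l : List (Fin n)}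
    (hl : ∀ s ∈ l, ∃ j, κ s = some (j, true)) {R R' : Fin 2 → ℕ} {w : ℝ}
    (h : Run (fun i => unitDemand (x i)) p (l.map Fin.succ) R R' w) :
    ∑ j, R' j ≤ ∑ j, R j - l.length := by
  have h1 := h.sum_supply_le_sub fun i hi R hR S hS => by
      obtain ⟨s, hs, rfl⟩ := List.mem_map.1 hi
      obtain ⟨j, hj⟩ := hl s hs
      obtain ⟨j', hj'⟩ := hR
      have := hκ s
      rw [hj] at this
      refine nonempty_of_mem_demand hS hj' ?_
      by_cases h : j' = j
      · exact h ▸ this.1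
      · simpa using (this.2 j' h).2
  simpa using h1

/-- Once the preferred item `j` is gone, a buyer who accepts both items must take the other one;
that `j` stays sold out is the invariant of the run. -/
lemma soldOut_other (hκ : ∀ s, Responds p (x (Fin.succ s)) (κ s)) {i j : Fin 2} (hij : i ≠ j)
    {l : List (Fin n)} (hl : ∀ s ∈ l, κ s = some (j, true)) {R R' : Fin 2 → ℕ} {w : ℝ}
    (hR : R j = 0) (h : Run (fun i => unitDemand (x i)) p (l.map Fin.succ) R R' w) :
    R' i ≤ R i - l.length := by
  have h1 := h.supply_le_sub (P := fun R => R j = 0) (j := i)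
    (fun R S h0 => Nat.le_zero.1 ((sell_le R S j).trans h0.le)) hR
    fun i' hi' R h0 hRi S hS => by
      obtain ⟨s, hs, rfl⟩ := List.mem_map.1 hi'
      have := hκ s
      rw [hl s hs] at this
      refine mem_of_only_available hS hRi (by simpa using (this.2 i hij).2) fun j' hj' => ?_
      rwa [show j' = j by omega]
  simpa using h1

/-- If everybody prefers item `j` and fewer than `k` buyers accept the other item, then letting
those come first leaves no more than `k` sales. -/
lemma worst_le_one_item (he : 0 ≤ e) (hx : ∀ s j, (x (Fin.succ s) j : ℝ) ≤ e)
    (hκ : ∀ s, Responds p (x (Fin.succ s)) (κ s)) {j : Fin 2}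
    (hpref : ∀ s i b, κ s = some (i, b) → i = j) (hboth : bothCount κ j ≤ k) :
    (worstOrderWelfare (fun _ => k) (fun i => unitDemand (x i)) p : ℝ) ≤
      e * k + ∑ j, (x 0 j : ℝ) := by
  obtain ⟨l, hmem, hnd⟩ : ∃ l : List (Fin n), (∀ s, s ∈ l ↔ κ s = some (j, true)) ∧ l.Nodup :=
    ⟨(List.finRange n).filter fun s => κ s = some (j, true), fun s => by simp,
      (List.nodup_finRange n).filter _⟩
  have hlen : l.length = bothCount κ j := by
    rw [← List.toFinset_card_of_nodup hnd, bothCount]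
    congr 1
    ext s
    simp [hmem]
  obtain ⟨R₁, R₂, R₃, w₁, w₂, w₃, h₁, h₂, h₃, hw⟩ := exists_runs (fun _ => k) x p hnd
  have e3 := big_value_le_sum h₃
  have e1 : w₁ ≤ e * l.length := by
    refine (h₁.value_le_sum (b := fun _ => e) fun i hi R S _ =>
      (unitDemand_bounds he hx l i hi).2 S).trans_eq ?_
    rw [List.map_const', List.sum_replicate, List.length_map, nsmul_eq_mul, mul_comm]
  have hR := soldOut_of_prefer hκ (fun s hs => ⟨true, (hmem s).1 hs⟩) h₁
  have e2 := h₂.value_add_le_item (j := j) he (unitDemand_bounds he hx _) fun i hi R S hS => by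
    obtain ⟨s, hs, rfl⟩ := List.mem_map.1 hi
    have hs : κ s ≠ some (j, true) := fun h => by simp [hmem, h] at hs
    have hr := hκ s
    rcases hκs : κ s with _ | ⟨i, b⟩
    · rw [hκs] at hr
      exact Or.inl (hr.eq_empty hS)
    · obtain rfl := hpref s i b hκs
      have hb : b = false := by
        by_contra h
        exact hs (by rw [hκs, Bool.of_not_eq_false h])
      subst hb
      rw [hκs] at hr
      refine S.eq_empty_or_nonempty.imp_right fun hne => ?_
      obtain ⟨i', hi', hle⟩ := exists_acceptable hS hne
      by_cases h : i' = i
      · exact h ▸ hi'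
      · exact absurd hle (by simpa using (hr.2 i' h).2)
  -- The natural subtraction in `hR` does not truncate, because `bothCount κ j ≤ k`.
  have h4 : (R₁ j : ℝ) + l.length ≤ k := by
    exact_mod_cast (by omega : R₁ j + l.length ≤ k)
  have : (0 : ℝ) ≤ e * R₂ j := by positivity
  nlinarith

open Classical in
/-- The welfare guarantees of the adversary depend on the responses of the small buyers only: `H₀`
bounds the sales without a big buyer, and `H j` the chance of a big buyer for item `j`. -/
lemma exists_adversary_bounds (hk : 1 ≤ k) {θ c : ℝ} (hc : 0 ≤ c) (hck : c ≤ k)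
    (hθ : θ * (k + c) = k) (κ : Fin n → Response) :
    ∃ (H₀ : ℝ) (H : Fin 2 → ℝ), 0 ≤ H₀ ∧ (∀ j, 0 ≤ H j) ∧
      H₀ + c * (H 0 + H 1) ≤ (2 * k + 2 * c) * payoff k θ (prefCount κ 0) (prefCount κ 1) +
        2 * c * (if Mixed κ then 1 else 0) ∧
      ∀ (p : Fin 2 → ℝ≥0) (x : Fin (n + 1) → Fin 2 → ℝ≥0) (e : ℝ), 0 ≤ e →
        (∀ s, Responds p (x (Fin.succ s)) (κ s)) → (∀ s j, (x (Fin.succ s) j : ℝ) ≤ e) →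
        (worstOrderWelfare (fun _ => k) (fun i => unitDemand (x i)) p : ℝ) ≤
          e * H₀ + ∑ j, (x 0 j : ℝ) ∧
        ∀ j, (∀ i, i ≠ j → x 0 i = 0) →
          (worstOrderWelfare (fun _ => k) (fun i => unitDemand (x i)) p : ℝ) ≤
            2 * k * e + x 0 j * H j := by
  have hk0 : (0 : ℝ) < k := by exact_mod_cast hk
  have hone : ∀ (p : Fin 2 → ℝ≥0) (x : Fin (n + 1) → Fin 2 → ℝ≥0) (e : ℝ), 0 ≤ e →
      (∀ s j, (x (Fin.succ s) j : ℝ) ≤ e) → ∀ j, (∀ i, i ≠ j → x 0 i = 0) →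
      (worstOrderWelfare (fun _ => k) (fun i => unitDemand (x i)) p : ℝ) ≤
        2 * k * e + x 0 j * 1 := fun p x e he hx j h0 => by
    have := worst_le_add_big (k := k) (p := p) he hx
    rwa [Finset.sum_eq_single j (fun i _ hi => by rw [h0 i hi, NNReal.coe_zero]) (by simp),
      ← mul_one (x 0 j : ℝ)] at this
  have hout : ∀ (j : Fin 2), k ≤ prefCount κ j → ∀ (p : Fin 2 → ℝ≥0)
      (x : Fin (n + 1) → Fin 2 → ℝ≥0) (e : ℝ), 0 ≤ e →
      (∀ s, Responds p (x (Fin.succ s)) (κ s)) → (∀ s j, (x (Fin.succ s) j : ℝ) ≤ e) →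
      (∀ i, i ≠ j → x 0 i = 0) →
      (worstOrderWelfare (fun _ => k) (fun i => unitDemand (x i)) p : ℝ) ≤ 2 * k * e :=
    fun j hj p x e he hκ hx h0 => by
      refine worst_le_of_soldOut he hx (l := (List.finRange n).filter fun s => ∃ b, κ s = some (j, b))
        ((List.nodup_finRange n).filter _) h0 fun R w hrun => ?_
      have := soldOut_of_prefer hκ (fun s hs => by simpa using hs) hrun
      rw [length_pref] at this
      omega
  have hfull : ∀ (p : Fin 2 → ℝ≥0) (x : Fin (n + 1) → Fin 2 → ℝ≥0) (e : ℝ), 0 ≤ e →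
      (∀ s j, (x (Fin.succ s) j : ℝ) ≤ e) →
      (worstOrderWelfare (fun _ => k) (fun i => unitDemand (x i)) p : ℝ) ≤
        e * (2 * k) + ∑ j, (x 0 j : ℝ) := fun p x e he hx => by
    rw [mul_comm e]
    exact worst_le_add_big he hx
  -- Few interested buyers: sales are bounded by their number, and item `j` can be sold out if `k`
  -- of them prefer it. By `hθ`, the factor `2 * k + 2 * c` turns the weights of `payoff` back into
  -- the values `1` and `c`.
  by_cases hN : prefCount κ 0 + prefCount κ 1 < 2 * k
  · refine ⟨(prefCount κ 0 + prefCount κ 1 : ℕ), fun j => if prefCount κ j < k then 1 else 0,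
      by positivity, fun j => by dsimp only; split_ifs <;> norm_num, ?_, fun p x e he hκ hx =>
        ⟨worst_le_interested he hx hκ, fun j h0 => ?_⟩⟩
    · rw [payoff, if_pos hN]
      set a : ℝ := if prefCount κ 0 < k then 1 else 0
      set b : ℝ := if prefCount κ 1 < k then 1 else 0
      set N : ℝ := ((prefCount κ 0 + prefCount κ 1 : ℕ) : ℝ)
      have h1 : (2 * k + 2 * c) * (θ * (N / (2 * k)) + (1 - θ) / 2 * (a + b)) = N + c * (a + b) := by
        have h2 : (2 * k + 2 * c) * (θ * (N / (2 * k)) + (1 - θ) / 2 * (a + b)) =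
            (θ * (k + c)) * N / k + ((k + c) - θ * (k + c)) * (a + b) := by
          field_simp
        rw [h2, hθ]
        field_simp
        ring
      rw [h1]
      have : (0 : ℝ) ≤ 2 * c * (if Mixed κ then 1 else 0) := by positivity
      linarith
    · dsimp only
      split_ifs with h
      · exact hone p x e he hx j h0
      · rw [mul_zero, add_zero]
        exact hout j (by omega) p x e he hκ hx h0
  have hpay : (2 * k + 2 * c) * payoff k θ (prefCount κ 0) (prefCount κ 1) = 2 * k := by
    rw [payoff, if_neg hN]
    linarith
  rw [hpay]
  -- In the mixed case only the trivial bounds are used; their excess `2 * c` is charged to the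
  -- indicator of this rare event.
  by_cases hmix : Mixed κ
  · refine ⟨2 * k, fun _ => 1, by positivity, fun _ => zero_le_one, ?_, fun p x e he hκ hx =>
      ⟨hfull p x e he hx, hone p x e he hx⟩⟩
    rw [if_pos hmix]
    linarith
  rw [if_neg hmix, mul_zero, add_zero]
  -- Some buyer accepts one item only. As the profile is not mixed, all interested buyers prefer the
  -- same item `j`, and there are at least `2 * k` of them.
  by_cases honly : ∃ s j, κ s = some (j, false)
  · obtain ⟨i, hi⟩ : ∃ i, prefCount κ i = 0 := by
      by_contra hcon
      push Not at hcon
      exact hmix ⟨honly, fun j => Nat.pos_of_ne_zero (hcon j)⟩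
    obtain ⟨j, hij, hcases⟩ : ∃ j : Fin 2, i ≠ j ∧ ∀ i', i' = i ∨ i' = j := by
      fin_cases i
      · exact ⟨1, by simp, fun i' => by fin_cases i' <;> simp⟩
      · exact ⟨0, by simp, fun i' => by fin_cases i' <;> simp⟩
    have hj : 2 * k ≤ prefCount κ j := by
      rcases hcases 0 with h0 | h0 <;> rcases hcases 1 with h1 | h1
      · exact absurd (h0.trans h1.symm) (by simp)
      · rw [h0, h1] at hN; omega
      · rw [h0, h1] at hN; omega
      · exact absurd (h0.trans h1.symm) (by simp)
    have hpref : ∀ s i' b, κ s = some (i', b) → i' = j := fun s i' b hs => by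
      refine (hcases i').resolve_left fun h => ?_
      have : s ∈ Finset.univ.filter fun s => ∃ b, κ s = some (i, b) := by
        simp [hs, h]
      rw [Finset.card_eq_zero.1 hi] at this
      simp at this
    -- With few flexible buyers the small sales are held to `k`, and only a big buyer for the
    -- unpreferred item can succeed. The resulting total `k + c` fits below `2 * k` because `c ≤ k`.
    by_cases hboth : bothCount κ j < k
    · refine ⟨k, fun j' => if j' = j then 0 else 1, by positivity,
        fun j => by dsimp only; split_ifs <;> norm_num, ?_, fun p x e he hκ hx =>
          ⟨worst_le_one_item he hx hκ hpref hboth.le, fun j' h0 => ?_⟩⟩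
      · rcases hcases 0 with h0 | h0 <;> rcases hcases 1 with h1 | h1
        · exact absurd (h0.trans h1.symm) (by simp)
        · simp only [h0, h1, if_neg hij, if_pos]; linarith
        · simp only [h0, h1, if_neg hij, if_pos]; linarith
        · exact absurd (h0.trans h1.symm) (by simp)
      · dsimp only
        split_ifs with h
        · subst h
          rw [mul_zero, add_zero]
          exact hout j' (by omega) p x e he hκ hx h0
        · exact hone p x e he hx j' h0
    · refine ⟨2 * k, fun _ => 0, by positivity, fun _ => le_rfl, by simp, fun p x e he hκ hx =>
        ⟨hfull p x e he hx, fun j' h0 => ?_⟩⟩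
      rw [mul_zero, add_zero]
      rcases hcases j' with rfl | rfl
      -- To sell out the unpreferred item, reserve `k` flexible buyers: the at least `k` others who
      -- prefer `j` come first and exhaust it, and then the reserved ones must take the other item.
      · set lb := ((List.finRange n).filter fun s => κ s = some (j, true)).take k with hlb
        have hlbmem : ∀ s ∈ lb, κ s = some (j, true) := fun s hs => by
          simpa using (List.mem_filter.1 (List.mem_of_mem_take hs)).2
        have hlblen : lb.length = k := by
          rw [hlb, List.length_take, length_filter_finRange]
          exact min_eq_left (by simpa [bothCount] using hboth)
        have hlbnd : lb.Nodup := ((List.nodup_finRange n).filter _).sublist (List.take_sublist _ _)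
        set la := (List.finRange n).filter fun s => (∃ b, κ s = some (j, b)) ∧ s ∉ lb with hla
        have hlalen : k ≤ la.length := by
          rw [hla, length_filter_finRange]
          have h1 : (Finset.univ.filter fun s => ∃ b, κ s = some (j, b)) ⊆
              (Finset.univ.filter fun s => (∃ b, κ s = some (j, b)) ∧ s ∉ lb) ∪ lb.toFinset :=
            fun s hs => by
              by_cases h : s ∈ lb
              · exact Finset.mem_union_right _ (by simpa using h)
              · exact Finset.mem_union_left _ (by simpa [h] using hs)
          have h2 := (Finset.card_le_card h1).trans (Finset.card_union_le _ _)
          rw [List.toFinset_card_of_nodup hlbnd, hlblen] at h2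
          have h3 := hj.trans h2
          omega
        refine worst_le_of_soldOut he hx (l := la ++ lb) ?_ h0 fun R w hrun => ?_
        · rw [List.nodup_append]
          refine ⟨(List.nodup_finRange n).filter _, hlbnd, ?_⟩
          rintro a ha b hb rfl
          simp [hla, hb] at ha
        · rw [List.map_append] at hrun
          obtain ⟨R₁, w₁, w₂, h₁, h₂, -⟩ := hrun.append
          have e1 := soldOut_of_prefer hκ (fun s hs => by
            have := (List.mem_filter.1 hs).2
            simp only [decide_eq_true_eq] at this
            exact this.1) h₁
          have e2 := soldOut_other hκ hij hlbmem (by omega) h₂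
          have e3 := h₁.supply_le j'
          omega
      · exact hout j' (by omega) p x e he hκ hx h0
  -- All interested buyers accept both items, and at least `2 * k` of them exhaust the whole stock.
  · push Not at honly
    refine ⟨2 * k, fun _ => 0, by positivity, fun _ => le_rfl, by simp, fun p x e he hκ hx =>
        ⟨hfull p x e he hx, fun j h0 => ?_⟩⟩
    rw [mul_zero, add_zero]
    refine worst_le_of_soldOut he hx (l := (List.finRange n).filter fun s => κ s ≠ none)
      ((List.nodup_finRange n).filter _) h0 fun R w hrun => ?_
    have := soldOut_of_both hκ (fun s hs => by
      have hs : κ s ≠ none := by simpa using hs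
      obtain ⟨⟨j, b⟩, hjb⟩ := Option.ne_none_iff_exists'.1 hs
      cases b
      · exact absurd hjb (honly s j)
      · exact ⟨j, hjb⟩) hrun
    rw [length_filter_finRange, card_interested, Fin.sum_const, smul_eq_mul] at this
    have h1 : R j ≤ ∑ j, R j := Finset.single_le_sum (fun _ _ => Nat.zero_le _) (Finset.mem_univ j)
    omega

end Adversary

/-! ## Product measures -/

section Product

variable {X : Type*} [MeasurableSpace X] {n : ℕ}

lemma measurePreserving_head_tail (μ : Fin (n + 1) → Measure X) [∀ i, IsProbabilityMeasure (μ i)] :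
    MeasurePreserving (fun w : Fin (n + 1) → X => (w 0, Fin.tail w)) (Measure.pi μ)
      ((μ 0).prod (Measure.pi (Fin.tail μ))) :=
  measurePreserving_piFinSuccAbove μ 0

lemma integral_head_tail (μ : Fin (n + 1) → Measure X) [∀ i, IsProbabilityMeasure (μ i)]
    (F : X × (Fin n → X) → ℝ) :
    ∫ w, F (w 0, Fin.tail w) ∂(Measure.pi μ) = ∫ z, F z ∂((μ 0).prod (Measure.pi (Fin.tail μ))) :=
  (measurePreserving_piFinSuccAbove μ 0).integral_comp' (f := MeasurableEquiv.piFinSuccAbove _ 0) F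

lemma integral_head_mul_tail (μ : Fin (n + 1) → Measure X) [∀ i, IsProbabilityMeasure (μ i)]
    (f : X → ℝ) (g : (Fin n → X) → ℝ) :
    ∫ w, f (w 0) * g (Fin.tail w) ∂(Measure.pi μ) =
      (∫ x, f x ∂(μ 0)) * ∫ y, g y ∂(Measure.pi (Fin.tail μ)) := by
  have : ∀ i, IsProbabilityMeasure (Fin.tail μ i) := fun i => inferInstanceAs
    (IsProbabilityMeasure (μ i.succ))
  rw [integral_head_tail μ fun z => f z.1 * g z.2, integral_prod_mul]

lemma integrable_head_mul_tail (μ : Fin (n + 1) → Measure X) [∀ i, IsProbabilityMeasure (μ i)]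
    {f : X → ℝ} {g : (Fin n → X) → ℝ} (hf : Integrable f (μ 0))
    (hg : Integrable g (Measure.pi (Fin.tail μ))) :
    Integrable (fun w : Fin (n + 1) → X => f (w 0) * g (Fin.tail w)) (Measure.pi μ) := by
  have : ∀ i, IsProbabilityMeasure (Fin.tail μ i) := fun i => inferInstanceAs
    (IsProbabilityMeasure (μ i.succ))
  exact (measurePreserving_head_tail μ).integrable_comp_of_integrable (hf.mul_prod hg)

end Product

/-! ### Independent responses and their counts. -/

instance : MeasurableSpace Response := ⊤

instance : DiscreteMeasurableSpace Response := ⟨fun _ => trivial⟩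

section Counts

variable (ν : Measure Response) [IsProbabilityMeasure ν]

/-- The responses that prefer item `j`. -/
def prefSet (j : Fin 2) : Set Response := {r | ∃ b, r = some (j, b)}

lemma prefCount_succ {n : ℕ} (κ : Fin (n + 1) → Response) (j : Fin 2) [Decidable (κ 0 ∈ prefSet j)] :
    prefCount κ j = (if κ 0 ∈ prefSet j then 1 else 0) + prefCount (Fin.tail κ) j := by
  simp only [prefCount, Finset.card_filter, Fin.sum_univ_succ]
  congr 1
  exact if_congr Iff.rfl rfl rfl

lemma integral_response_eq (F : Response → ℝ) {x y z : ℝ} (hx : ∀ b, F (some (0, b)) = x)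
    (hy : ∀ b, F (some (1, b)) = y) (hz : F none = z) :
    ∫ r, F r ∂ν = ν.real (prefSet 0) * x + ν.real (prefSet 1) * y +
      (1 - ν.real (prefSet 0) - ν.real (prefSet 1)) * z := by
  have hF : ∀ r, F r = (prefSet 0).indicator 1 r * (x - z) + (prefSet 1).indicator 1 r * (y - z) + z :=
    fun r => by
      rcases r with _ | ⟨j, b⟩
      · simp [prefSet, hz]
      · fin_cases j
        · simp [prefSet, Set.indicator, hx]
        · simp [prefSet, Set.indicator, hy]
  have hi : ∀ j, Integrable ((prefSet j).indicator (1 : Response → ℝ)) ν := fun j => .of_finite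
  simp_rw [hF]
  rw [integral_add .of_finite .of_finite, integral_add .of_finite .of_finite, integral_mul_const,
    integral_mul_const, integral_indicator_one (.of_discrete), integral_indicator_one .of_discrete,
    integral_const]
  simp
  ring

/-- Integrating out the first buyer reproduces the recursion of `trinomialExp`. -/
lemma integral_counts_eq (h : ℕ → ℕ → ℝ) (n a b : ℕ) :
    ∫ κ, h (a + prefCount κ 0) (b + prefCount κ 1) ∂(Measure.pi fun _ : Fin n => ν) =
      trinomialExp (ν.real (prefSet 0)) (ν.real (prefSet 1)) h n a b := by
  classical
  induction n generalizing a b with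
  | zero =>
    simp [trinomialExp, prefCount]
  | succ n ih =>
    have h1 := integral_head_tail (fun _ : Fin (n + 1) => ν) fun z : Response × (Fin n → Response) =>
      h ((a + if z.1 ∈ prefSet 0 then 1 else 0) + prefCount z.2 0)
        ((b + if z.1 ∈ prefSet 1 then 1 else 0) + prefCount z.2 1)
    have h2 : Fin.tail (fun _ : Fin (n + 1) => ν) = fun _ => ν := rfl
    rw [h2] at h1
    simp only [add_assoc, ← prefCount_succ] at h1
    have hmem : ∀ i j b, some (i, b) ∈ prefSet j ↔ i = j := fun i j b => by
      cases b <;> simp [prefSet]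
    have hnone : ∀ j, none ∉ prefSet j := fun j => by simp [prefSet]
    rw [h1, integral_prod _ .of_finite]
    simp only [← add_assoc]
    rw [integral_response_eq ν _ (x := trinomialExp _ _ h n (a + 1) b)
      (y := trinomialExp _ _ h n a (b + 1)) (z := trinomialExp _ _ h n a b), trinomialExp]
    all_goals simp [hmem, hnone, ← ih]

open Classical in
-- Union bound over the buyers.
lemma integral_mixed_le {n : ℕ} {A : Set Response}
    (hA : ∀ κ : Fin n → Response, Mixed κ → ∃ s, κ s ∈ A) :
    ∫ κ, (if Mixed κ then (1 : ℝ) else 0) ∂(Measure.pi fun _ : Fin n => ν) ≤ n * ν.real A := by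
  have h1 : ∀ κ : Fin n → Response, (if Mixed κ then (1 : ℝ) else 0) ≤
      ∑ s, A.indicator 1 (κ s) := fun κ => by
    split_ifs with h
    · obtain ⟨s, hs⟩ := hA κ h
      refine le_trans (by rw [Set.indicator_of_mem hs]; rfl) (Finset.single_le_sum
        (f := fun s => A.indicator (1 : Response → ℝ) (κ s))
        (fun s _ => Set.indicator_nonneg (fun _ _ => zero_le_one) _) (Finset.mem_univ s))
    · exact Finset.sum_nonneg fun s _ => Set.indicator_nonneg (fun _ _ => zero_le_one) _
  refine (integral_mono .of_finite .of_finite h1).trans_eq ?_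
  rw [integral_finsetSum _ fun _ _ => .of_finite]
  have h2 : ∀ s : Fin n, ∫ κ, A.indicator (1 : Response → ℝ) (κ s) ∂(Measure.pi fun _ : Fin n => ν) =
      ν.real A := fun s => by
    rw [← integral_map (φ := fun κ : Fin n → Response => κ s) (f := A.indicator (1 : Response → ℝ))
      .of_discrete .of_discrete, (measurePreserving_eval (fun _ : Fin n => ν) s).map_eq,
      integral_indicator_one .of_discrete]
  simp [h2]

end Counts

/-! ## Responses of random buyers -/

section Responses

open Classical in
/-- The response to the prices `p` of a buyer with item values `x`. -/
def response (p x : Fin 2 → ℝ≥0) : Response :=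
  if x 0 ≤ p 0 ∧ x 1 ≤ p 1 then none
  else if (x 1 : ℝ) - p 1 < x 0 - p 0 then (if p 1 < x 1 then some (0, true) else some (0, false))
  else (if p 0 < x 0 then some (1, true) else some (1, false))

lemma measurable_response (p : Fin 2 → ℝ≥0) : Measurable (response p) := by
  unfold response
  refine Measurable.ite ?_ measurable_const (Measurable.ite ?_ (Measurable.ite ?_ measurable_const
    measurable_const) (Measurable.ite ?_ measurable_const measurable_const))
  · exact (measurableSet_le (by fun_prop) (by fun_prop)).inter
      (measurableSet_le (by fun_prop) (by fun_prop))
  all_goals exact measurableSet_lt (by fun_prop) (by fun_prop)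

/-- The buyer with values `x` faces no ties at the prices `p`. -/
def Generic (p x : Fin 2 → ℝ≥0) : Prop :=
  x 0 ≠ p 0 ∧ x 1 ≠ p 1 ∧ (x 0 : ℝ) - p 0 ≠ x 1 - p 1

lemma responds_response {p x : Fin 2 → ℝ≥0} (h : Generic p x) : Responds p x (response p x) := by
  obtain ⟨h0, h1, h01⟩ := h
  rw [response]
  split_ifs with ha hb hc hc
  · intro j
    fin_cases j
    · exact lt_of_le_of_ne ha.1 h0
    · exact lt_of_le_of_ne ha.2 h1
  · refine ⟨?_, fun i hi => ?_⟩
    · rw [← NNReal.coe_lt_coe] at hc ⊢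
      linarith
    · obtain rfl : i = 1 := by omega
      exact ⟨hb, by simpa using hc⟩
  · refine ⟨?_, fun i hi => ?_⟩
    · by_contra hcon
      exact ha ⟨not_lt.1 hcon, not_lt.1 hc⟩
    · obtain rfl : i = 1 := by omega
      exact ⟨hb, by simpa using lt_of_le_of_ne (not_lt.1 hc) h1⟩
  · have hb' := lt_of_le_of_ne (not_lt.1 hb) h01
    refine ⟨?_, fun i hi => ?_⟩
    · rw [← NNReal.coe_lt_coe] at hc ⊢
      linarith
    · obtain rfl : i = 0 := by omega
      exact ⟨hb', by simpa using hc⟩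
  · have hb' := lt_of_le_of_ne (not_lt.1 hb) h01
    refine ⟨?_, fun i hi => ?_⟩
    · by_contra hcon
      exact ha ⟨not_lt.1 hc, not_lt.1 hcon⟩
    · obtain rfl : i = 0 := by omega
      exact ⟨hb', by simpa using lt_of_le_of_ne (not_lt.1 hc) h0⟩

end Responses

/-! ## The hard instance -/

section HardInstance

open unitInterval

/-- The values of a small buyer: both items are worth about `1`, and the second one is worth a bit
more. -/
def smallValue (δ η : ℝ≥0) (u : I × I) (j : Fin 2) : ℝ≥0 :=
  1 + δ * toNNReal u.1 + if j = 1 then η * toNNReal u.2 else 0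

/-- The values of the big buyer: with probability `ρ` each, one of the items is worth about `M`;
otherwise both are worth almost nothing. -/
def bigValue (ρ M δ : ℝ≥0) (u : I) (j : Fin 2) : ℝ≥0 :=
  if (u : ℝ) < ρ then (if j = 0 then M - toNNReal u else 0)
  else if (u : ℝ) < 2 * ρ then (if j = 1 then M - toNNReal u else 0)
  else if j = 0 then δ * toNNReal u else 0

lemma measurable_smallValue (δ η : ℝ≥0) : Measurable (smallValue δ η) := by
  refine measurable_pi_lambda _ fun j => ?_
  have h : Measurable (toNNReal : I → ℝ≥0) := toNNReal_continuous.measurable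
  unfold smallValue
  split_ifs <;> fun_prop

lemma measurable_bigValue (ρ M δ : ℝ≥0) : Measurable (bigValue ρ M δ) := by
  refine measurable_pi_lambda _ fun j => ?_
  have h : Measurable (toNNReal : I → ℝ≥0) := toNNReal_continuous.measurable
  unfold bigValue
  refine Measurable.ite (measurableSet_lt (by fun_prop) (by fun_prop)) ?_
    (Measurable.ite (measurableSet_lt (by fun_prop) (by fun_prop)) ?_ ?_)
  all_goals split_ifs <;> fun_prop

def smallDist (δ η : ℝ≥0) : Measure (Fin 2 → ℝ≥0) := (volume : Measure (I × I)).map (smallValue δ η)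

def bigDist (ρ M δ : ℝ≥0) : Measure (Fin 2 → ℝ≥0) := (volume : Measure I).map (bigValue ρ M δ)

instance (δ η : ℝ≥0) : IsProbabilityMeasure (smallDist δ η) :=
  Measure.isProbabilityMeasure_map (measurable_smallValue δ η).aemeasurable

instance (ρ M δ : ℝ≥0) : IsProbabilityMeasure (bigDist ρ M δ) :=
  Measure.isProbabilityMeasure_map (measurable_bigValue ρ M δ).aemeasurable

/-! ### Ties and atoms have probability zero. -/

lemma volume_fst_preimage_null {T : Set I} (hT : T.Subsingleton) :
    volume {u : I × I | u.1 ∈ T} = 0 := by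
  have h : {u : I × I | u.1 ∈ T} = T ×ˢ Set.univ := by ext; simp
  rw [h, Measure.volume_eq_prod, Measure.prod_prod, hT.measure_zero, zero_mul]

lemma volume_null_of_sections {S : Set (I × I)} (hS : MeasurableSet S)
    (h : ∀ s, {t | (s, t) ∈ S}.Subsingleton) : volume S = 0 := by
  rw [Measure.volume_eq_prod, Measure.measure_prod_null hS]
  exact .of_forall fun s => (h s).measure_zero _

lemma coe_smallValue (δ η : ℝ≥0) (u : I × I) (j : Fin 2) :
    (smallValue δ η u j : ℝ) = 1 + δ * u.1 + if j = 1 then η * (u.2 : ℝ) else 0 := by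
  rw [smallValue]
  split_ifs <;> simp

lemma ae_smallDist {δ η : ℝ≥0} {P : (Fin 2 → ℝ≥0) → Prop} (hP : MeasurableSet {x | P x})
    (h : ∀ᵐ u : I × I, P (smallValue δ η u)) : ∀ᵐ x ∂(smallDist δ η), P x :=
  (ae_map_iff (measurable_smallValue δ η).aemeasurable hP).2 h

lemma ae_smallValue_zero_ne {δ : ℝ≥0} (η : ℝ≥0) (hδ : 0 < δ) (y : ℝ≥0) :
    ∀ᵐ u : I × I, smallValue δ η u 0 ≠ y := by
  refine measure_mono_null (fun u hu => ?_)
    (volume_fst_preimage_null (T := {s : I | 1 + (δ : ℝ) * s = y}) fun s hs t ht => ?_)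
  · have hu : smallValue δ η u 0 = y := not_not.1 hu
    have := coe_smallValue δ η u 0
    rw [hu] at this
    simpa using this.symm
  · have h1 : (δ : ℝ) * s = δ * t := by
      have := hs.trans ht.symm
      linarith
    exact Subtype.ext (mul_left_cancel₀ (NNReal.coe_ne_zero.2 hδ.ne') h1)

/-- A tie at item `0` pins down the first uniform variable. Each of the other two ties pins down the
second one, given the first. -/
lemma ae_generic {δ η : ℝ≥0} (hδ : 0 < δ) (hη : 0 < η) (p : Fin 2 → ℝ≥0) :
    ∀ᵐ x ∂(smallDist δ η), Generic p x := by
  have hη' : (η : ℝ) ≠ 0 := NNReal.coe_ne_zero.2 hη.ne'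
  have hm := measurable_smallValue δ η
  have hm0 : Measurable fun u => smallValue δ η u 0 := measurable_pi_iff.1 hm 0
  have hm1 : Measurable fun u => smallValue δ η u 1 := measurable_pi_iff.1 hm 1
  refine ae_smallDist ?_ ?_
  · refine MeasurableSet.inter ?_ (MeasurableSet.inter ?_ ?_)
    all_goals exact (measurableSet_eq_fun (by fun_prop) (by fun_prop)).compl
  · refine (ae_smallValue_zero_ne η hδ (p 0)).and (Filter.Eventually.and ?_ ?_)
    · refine measure_mono_null (t := {u | smallValue δ η u 1 = p 1}) (fun u hu => not_not.1 hu)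
        (volume_null_of_sections (measurableSet_eq_fun hm1 measurable_const) fun s t ht t' ht' => ?_)
      have h1 := coe_smallValue δ η (s, t) 1
      have h2 := coe_smallValue δ η (s, t') 1
      rw [show smallValue δ η (s, t) 1 = p 1 from ht] at h1
      rw [show smallValue δ η (s, t') 1 = p 1 from ht'] at h2
      simp only [if_true] at h1 h2
      exact Subtype.ext (mul_left_cancel₀ hη' (by linarith))
    · refine measure_mono_null
        (t := {u | (smallValue δ η u 0 : ℝ) - p 0 = smallValue δ η u 1 - p 1})
        (fun u hu => not_not.1 hu) (volume_null_of_sections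
          (measurableSet_eq_fun (by fun_prop) (by fun_prop)) fun s t ht t' ht' => ?_)
      have h1 : (smallValue δ η (s, t) 0 : ℝ) - p 0 = smallValue δ η (s, t) 1 - p 1 := ht
      have h2 : (smallValue δ η (s, t') 0 : ℝ) - p 0 = smallValue δ η (s, t') 1 - p 1 := ht'
      simp [coe_smallValue] at h1 h2
      exact Subtype.ext (mul_left_cancel₀ hη' (by linarith))

lemma ae_smallDist_bounds (δ η : ℝ≥0) :
    ∀ᵐ x ∂(smallDist δ η), ∀ j, (1 : ℝ) ≤ x j ∧ (x j : ℝ) ≤ 1 + δ + η := by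
  refine ae_smallDist ?_ (.of_forall fun u j => ?_)
  · have h1 : ∀ j : Fin 2, MeasurableSet {x : Fin 2 → ℝ≥0 | (1 : ℝ) ≤ x j} := fun j =>
      measurableSet_le (by fun_prop) (by fun_prop)
    have h2 : ∀ j : Fin 2, MeasurableSet {x : Fin 2 → ℝ≥0 | (x j : ℝ) ≤ 1 + δ + η} := fun j =>
      measurableSet_le (by fun_prop) (by fun_prop)
    rw [Set.ofPred_forall]
    exact MeasurableSet.iInter fun j => (h1 j).inter (h2 j)
  · rw [coe_smallValue]
    have h1 := u.1.2.1
    have h2 := u.1.2.2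
    have h3 := u.2.2.1
    have h4 := u.2.2.2
    have h5 := δ.2
    have h6 := η.2
    have h7 : (δ : ℝ) * u.1 ≤ δ := mul_le_of_le_one_right h5 h2
    have h8 : (η : ℝ) * u.2 ≤ η := mul_le_of_le_one_right h6 h4
    have h9 : 0 ≤ (δ : ℝ) * u.1 := by positivity
    have h10 : 0 ≤ (η : ℝ) * u.2 := by positivity
    split_ifs <;> constructor <;> linarith

lemma nullSingleton_smallDist {δ : ℝ≥0} (η : ℝ≥0) (hδ : 0 < δ) :
    NullSingletonClass (smallDist δ η) where
  measure_singleton w := by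
    rw [smallDist, Measure.map_apply (measurable_smallValue δ η) (measurableSet_singleton w)]
    refine measure_mono_null (fun u hu => ?_) (ae_smallValue_zero_ne η hδ (w 0))
    simpa using congrFun (Set.mem_singleton_iff.1 hu) 0

lemma toNNReal_le_one (u : I) : toNNReal u ≤ 1 := NNReal.coe_le_coe.1 u.2.2

lemma bigValue_cases (ρ M δ : ℝ≥0) (u : I) :
    ((u : ℝ) < ρ ∧ bigValue ρ M δ u 0 = M - toNNReal u ∧ bigValue ρ M δ u 1 = 0) ∨
    (ρ ≤ (u : ℝ) ∧ (u : ℝ) < 2 * ρ ∧ bigValue ρ M δ u 0 = 0 ∧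
      bigValue ρ M δ u 1 = M - toNNReal u) ∨
    (2 * ρ ≤ (u : ℝ) ∧ bigValue ρ M δ u 0 = δ * toNNReal u ∧ bigValue ρ M δ u 1 = 0) := by
  by_cases h1 : (u : ℝ) < ρ
  · exact Or.inl ⟨h1, by simp [bigValue, h1], by simp [bigValue, h1]⟩
  by_cases h2 : (u : ℝ) < 2 * ρ
  · exact Or.inr (Or.inl ⟨not_lt.1 h1, h2, by simp [bigValue, h1, h2], by simp [bigValue, h1, h2]⟩)
  · exact Or.inr (Or.inr ⟨not_lt.1 h2, by simp [bigValue, h1, h2], by simp [bigValue, h1, h2]⟩)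

/-- In each of the three types one coordinate is an injective function of the uniform variable, so a
given value vector has at most three preimages. -/
lemma nullSingleton_bigDist (ρ : ℝ≥0) {M δ : ℝ≥0} (hM : 1 ≤ M) (hδ : 0 < δ) :
    NullSingletonClass (bigDist ρ M δ) where
  measure_singleton w := by
    rw [bigDist, Measure.map_apply (measurable_bigValue ρ M δ) (measurableSet_singleton w)]
    have hinj : ∀ y : ℝ≥0, {u : I | M - toNNReal u = y}.Subsingleton := fun y u hu v hv => by
      have h : ∀ u : I, toNNReal u ≤ M := fun u => (toNNReal_le_one u).trans hM
      have h1 : M - toNNReal u = M - toNNReal v := hu.trans hv.symm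
      have h2 := (tsub_right_inj (h u) (h v)).1 h1
      exact Subtype.ext (congrArg NNReal.toReal h2)
    have hinj' : ∀ y : ℝ≥0, {u : I | δ * toNNReal u = y}.Subsingleton := fun y u hu v hv => by
      have h1 : δ * toNNReal u = δ * toNNReal v := hu.trans hv.symm
      exact Subtype.ext (congrArg NNReal.toReal (mul_left_cancel₀ hδ.ne' h1))
    refine measure_mono_null (t := {u : I | M - toNNReal u = w 0} ∪ ({u : I | M - toNNReal u = w 1} ∪
      {u : I | δ * toNNReal u = w 0})) (fun u hu => ?_) ?_
    · have hu : bigValue ρ M δ u = w := hu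
      rw [← hu]
      rcases bigValue_cases ρ M δ u with ⟨-, h, -⟩ | ⟨-, -, -, h⟩ | ⟨-, h, -⟩
      · exact Or.inl h.symm
      · exact Or.inr (Or.inl h.symm)
      · exact Or.inr (Or.inr h.symm)
    · exact measure_union_null ((hinj _).measure_zero _)
        (measure_union_null ((hinj _).measure_zero _) ((hinj' _).measure_zero _))

/-- The three possible types of the big buyer. -/
def BigTypes (M δ : ℝ≥0) (x : Fin 2 → ℝ≥0) : Prop :=
  (M - 1 ≤ x 0 ∧ x 0 ≤ M ∧ x 1 = 0) ∨ (M - 1 ≤ x 1 ∧ x 1 ≤ M ∧ x 0 = 0) ∨ (x 0 ≤ δ ∧ x 1 = 0)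

lemma bigTypes_bigValue (ρ M δ : ℝ≥0) (u : I) : BigTypes M δ (bigValue ρ M δ u) := by
  have h1 := toNNReal_le_one u
  unfold BigTypes
  rcases bigValue_cases ρ M δ u with ⟨-, h, h'⟩ | ⟨-, -, h', h⟩ | ⟨-, h, h'⟩
  · rw [h, h']
    exact Or.inl ⟨tsub_le_tsub_left h1 M, tsub_le_self, rfl⟩
  · rw [h, h']
    exact Or.inr (Or.inl ⟨tsub_le_tsub_left h1 M, tsub_le_self, rfl⟩)
  · rw [h, h']
    exact Or.inr (Or.inr ⟨mul_le_of_le_one_right zero_le h1, rfl⟩)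

lemma ae_bigTypes (ρ M δ : ℝ≥0) : ∀ᵐ x ∂(bigDist ρ M δ), BigTypes M δ x := by
  refine (ae_map_iff (measurable_bigValue ρ M δ).aemeasurable ?_).2
    (.of_forall (bigTypes_bigValue ρ M δ))
  refine MeasurableSet.union (MeasurableSet.inter ?_ (MeasurableSet.inter ?_ ?_))
    (MeasurableSet.union (MeasurableSet.inter ?_ (MeasurableSet.inter ?_ ?_))
      (MeasurableSet.inter ?_ ?_))
  · exact measurableSet_le (by fun_prop) (by fun_prop)
  · exact measurableSet_le (by fun_prop) (by fun_prop)
  · exact measurableSet_eq_fun (by fun_prop) (by fun_prop)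
  · exact measurableSet_le (by fun_prop) (by fun_prop)
  · exact measurableSet_le (by fun_prop) (by fun_prop)
  · exact measurableSet_eq_fun (by fun_prop) (by fun_prop)
  · exact measurableSet_le (by fun_prop) (by fun_prop)
  · exact measurableSet_eq_fun (by fun_prop) (by fun_prop)

/-- The event that the big buyer is interested in item `j`. -/
def bigEvent (M : ℝ≥0) (j : Fin 2) : Set (Fin 2 → ℝ≥0) := {x | M - 1 ≤ x j}

lemma measurableSet_bigEvent (M : ℝ≥0) (j : Fin 2) : MeasurableSet (bigEvent M j) :=
  measurableSet_le (by fun_prop) (by fun_prop)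

lemma bigDist_real_bigEvent {ρ M δ : ℝ≥0} (hρ : 2 * ρ ≤ 1) (hM : δ < M - 1) (j : Fin 2) :
    (bigDist ρ M δ).real (bigEvent M j) = ρ := by
  have hρ' : 2 * (ρ : ℝ) ≤ 1 := by exact_mod_cast hρ
  have hρ0 := ρ.2
  have h0M : 0 < M - 1 := zero_le.trans_lt hM
  let a : I := ⟨ρ, hρ0, by linarith⟩
  let b : I := ⟨2 * ρ, by positivity, hρ'⟩
  rw [measureReal_def, bigDist, Measure.map_apply (measurable_bigValue ρ M δ)
    (measurableSet_bigEvent M j)]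
  have hlow : ∀ u : I, M - 1 ≤ M - toNNReal u := fun u => tsub_le_tsub_left (toNNReal_le_one u) M
  have hδ : ∀ u : I, ¬ M - 1 ≤ δ * toNNReal u := fun u h =>
    (h.trans (mul_le_of_le_one_right zero_le (toNNReal_le_one u))).not_gt hM
  have h0 : ¬ M - 1 ≤ 0 := not_le.2 h0M
  have key0 : bigValue ρ M δ ⁻¹' bigEvent M 0 = Set.Iio a := by
    ext u
    rw [Set.mem_preimage, bigEvent, Set.mem_ofPred_eq, Set.mem_Iio, ← Subtype.coe_lt_coe]
    rcases bigValue_cases ρ M δ u with ⟨hu, h, -⟩ | ⟨hu, -, h, -⟩ | ⟨hu, h, -⟩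
    · exact iff_of_true (h ▸ hlow u) hu
    · exact iff_of_false (h ▸ h0) (not_lt.2 hu)
    · exact iff_of_false (h ▸ hδ u) (not_lt.2 (by simp only [a]; linarith))
  have key1 : bigValue ρ M δ ⁻¹' bigEvent M 1 = Set.Ico a b := by
    ext u
    rw [Set.mem_preimage, bigEvent, Set.mem_ofPred_eq, Set.mem_Ico, ← Subtype.coe_lt_coe,
      ← Subtype.coe_le_coe]
    rcases bigValue_cases ρ M δ u with ⟨hu, -, h⟩ | ⟨hu, hu', -, h⟩ | ⟨hu, -, h⟩
    · exact iff_of_false (h ▸ h0) fun hc => hc.1.not_gt hu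
    · exact iff_of_true (h ▸ hlow u) ⟨hu, hu'⟩
    · exact iff_of_false (h ▸ h0) fun hc => hc.2.not_ge hu
  revert j
  rw [Fin.forall_fin_two, key0, key1, volume_Iio, volume_Ico]
  refine ⟨ENNReal.toReal_ofReal hρ0, ?_⟩
  have hab : (b : ℝ) - a = ρ := by simp only [a, b]; ring
  rw [hab]
  exact ENNReal.toReal_ofReal hρ0

/-- The probability that a small buyer accepts exactly one item is small, or all small buyers
prefer the same item. -/
lemma exists_small_response_set {δ η : ℝ≥0} (hδ : 0 < δ) (p : Fin 2 → ℝ≥0) :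
    ∃ A : Set Response, (∀ (n : ℕ) (κ : Fin n → Response), Mixed κ → ∃ s, κ s ∈ A) ∧
      ((smallDist δ η).map (response p)).real A ≤ 2 * η / δ := by
  have hm := measurable_smallValue δ η
  have hr := measurable_response p
  have hδ' : (0 : ℝ) < δ := hδ
  have hη' := η.2
  have hval : ∀ A : Set Response, ((smallDist δ η).map (response p)).real A =
      (volume {u : I × I | response p (smallValue δ η u) ∈ A}).toReal := fun A => by
    rw [measureReal_def, smallDist, Measure.map_map hr hm,
      Measure.map_apply (hr.comp hm) .of_discrete]
    rfl
  have hpref : ∀ j (n : ℕ) (κ : Fin n → Response), Mixed κ → ∃ s, κ s ∈ prefSet j :=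
    fun j n κ h => by
      obtain ⟨s, hs⟩ := Finset.card_pos.1 (h.2 j)
      exact ⟨s, (Finset.mem_filter.1 hs).2⟩
  have hdiff : ∀ u : I × I, (smallValue δ η u 1 : ℝ) = smallValue δ η u 0 + η * u.2 := fun u => by
    simp [coe_smallValue]
  have hbd : ∀ u : I × I, 0 ≤ (η : ℝ) * u.2 ∧ (η : ℝ) * u.2 ≤ η := fun u =>
    ⟨mul_nonneg hη' u.2.2.1, mul_le_of_le_one_right hη' u.2.2.2⟩
  -- Item `1` is worth at least as much as item `0`; if it is also cheaper, nobody prefers item `0`.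
  rcases lt_or_ge (p 1 : ℝ) (p 0) with h1 | h1
  · refine ⟨prefSet 0, hpref 0, ?_⟩
    have : {u : I × I | response p (smallValue δ η u) ∈ prefSet 0} = ∅ := by
      refine Set.eq_empty_of_forall_notMem fun u hu => ?_
      obtain ⟨b, hb⟩ := hu
      have h2 := hdiff u
      have h3 := hbd u
      rw [response, if_neg (c := _ < _) (by linarith)] at hb
      split_ifs at hb <;> simp at hb
    rw [hval, this, measure_empty, ENNReal.toReal_zero]
    positivity
  -- The extra value of item `1` is at most `η`; if its extra price exceeds this, nobody prefers
  -- item `1`.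
  rcases lt_or_ge (η : ℝ) (p 1 - p 0) with h2 | h2
  · refine ⟨prefSet 1, hpref 1, ?_⟩
    have : {u : I × I | response p (smallValue δ η u) ∈ prefSet 1} = ∅ := by
      refine Set.eq_empty_of_forall_notMem fun u hu => ?_
      obtain ⟨b, hb⟩ := hu
      have h2 := hdiff u
      have h3 := hbd u
      rw [response, if_pos (c := _ < _) (by linarith)] at hb
      split_ifs at hb <;> simp at hb
    rw [hval, this, measure_empty, ENNReal.toReal_zero]
    positivity
  -- With a price gap in `[0, η]`, accepting exactly one item forces `x 0` to lie within `η` of `p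
  -- 0`. This confines the first uniform variable to a window of width `2 * η / δ`.
  · refine ⟨{r | ∃ j, r = some (j, false)}, fun n κ h => h.1, ?_⟩
    rw [hval]
    have hsub : {u : I × I | response p (smallValue δ η u) ∈ {r | ∃ j, r = some (j, false)}} ⊆
        ((↑) ⁻¹' Set.Icc ((p 0 - 1 - η) / δ : ℝ) ((p 0 - 1 + η) / δ) : Set I) ×ˢ Set.univ := by
      rintro u ⟨j, hj⟩
      refine ⟨?_, trivial⟩
      have h3 := hdiff u
      have h4 := hbd u
      have h5 : (smallValue δ η u 0 : ℝ) = 1 + δ * u.1 := by simp [coe_smallValue]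
      rw [Set.mem_preimage, Set.mem_Icc, div_le_iff₀ hδ', le_div_iff₀ hδ']
      rw [response] at hj
      split_ifs at hj with ha hb hc hc
      · simp at hj
      · have hc : (smallValue δ η u 1 : ℝ) ≤ p 1 := not_lt.1 hc
        have ha : ¬ (smallValue δ η u 0 : ℝ) ≤ p 0 := fun h => ha ⟨h, hc⟩
        push Not at ha
        constructor <;> linarith
      · simp at hj
      · have hc : (smallValue δ η u 0 : ℝ) ≤ p 0 := not_lt.1 hc
        have ha : ¬ (smallValue δ η u 1 : ℝ) ≤ p 1 := fun h => ha ⟨hc, h⟩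
        push Not at ha
        constructor <;> linarith
    have hvol : volume (((↑) ⁻¹' Set.Icc ((p 0 - 1 - η) / δ : ℝ) ((p 0 - 1 + η) / δ) : Set I)
        ×ˢ (Set.univ : Set I)) ≤ ENNReal.ofReal (2 * η / δ) := by
      rw [Measure.volume_eq_prod, Measure.prod_prod, measure_univ, mul_one,
        measurePreserving_coe.measure_preimage measurableSet_Icc.nullMeasurableSet]
      refine (Measure.restrict_apply_le _ _).trans_eq ?_
      rw [Real.volume_Icc]
      congr 1
      ring
    exact ENNReal.toReal_le_of_le_ofReal (by positivity) ((measure_mono hsub).trans hvol)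

end HardInstance

/-! ### Expected welfare and prophet on the hard instance. -/

section HardInstanceBounds

variable {n k : ℕ} {ρ M δ η : ℝ≥0}

/-- One big buyer and `n` small buyers. -/
def hardDist (n : ℕ) (ρ M δ η : ℝ≥0) : Fin (n + 1) → Measure (Fin 2 → ℝ≥0) :=
  Fin.cons (bigDist ρ M δ) fun _ => smallDist δ η

instance (n : ℕ) (ρ M δ η : ℝ≥0) (i : Fin (n + 1)) :
    IsProbabilityMeasure (hardDist n ρ M δ η i) := by
  refine Fin.cases ?_ (fun s => ?_) i
  · exact inferInstanceAs (IsProbabilityMeasure (bigDist ρ M δ))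
  · exact inferInstanceAs (IsProbabilityMeasure (smallDist δ η))

lemma tail_hardDist (n : ℕ) (ρ M δ η : ℝ≥0) :
    Fin.tail (hardDist n ρ M δ η) = fun _ => smallDist δ η := rfl

lemma BigTypes.le {x : Fin 2 → ℝ≥0} (h : BigTypes M δ x) (j : Fin 2) : x j ≤ M + δ := by
  have h1 : M ≤ M + δ := le_self_add
  have h2 : δ ≤ M + δ := le_add_self
  revert j
  rw [Fin.forall_fin_two]
  rcases h with ⟨-, h, h'⟩ | ⟨-, h, h'⟩ | ⟨h, h'⟩
  · exact ⟨h.trans h1, h' ▸ zero_le⟩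
  · exact ⟨h' ▸ zero_le, h.trans h1⟩
  · exact ⟨h.trans h2, h' ▸ zero_le⟩

lemma integrable_hardDist (n : ℕ) (ρ M δ η : ℝ≥0) (i : Fin (n + 1)) (j : Fin 2) :
    Integrable (fun w : Fin 2 → ℝ≥0 => (w j : ℝ)) (hardDist n ρ M δ η i) := by
  have hm : ∀ μ : Measure (Fin 2 → ℝ≥0), AEStronglyMeasurable (fun w : Fin 2 → ℝ≥0 => (w j : ℝ)) μ :=
    fun μ => (by fun_prop : Measurable fun w : Fin 2 → ℝ≥0 => (w j : ℝ)).aestronglyMeasurable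
  refine Fin.cases ?_ (fun s => ?_) i
  · refine Integrable.of_bound (C := (M + δ : ℝ≥0)) (hm _) ?_
    filter_upwards [ae_bigTypes ρ M δ] with x hx
    rw [NNReal.norm_eq]
    exact NNReal.coe_le_coe.2 (hx.le j)
  · refine Integrable.of_bound (C := 1 + δ + η) (hm _) ?_
    filter_upwards [ae_smallDist_bounds δ η] with x hx
    rw [NNReal.norm_eq]
    exact (hx j).2

def hardInstance (n k : ℕ) (ρ M δ η : ℝ≥0) (hM : 1 ≤ M) (hδ : 0 < δ) : Instance 2 where
  buyers := n + 1
  supply := fun _ => k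
  dist := hardDist n ρ M δ η
  isProb := inferInstance
  atomless := Fin.cases (nullSingleton_bigDist ρ hM hδ) fun _ => nullSingleton_smallDist η hδ
  integrable := integrable_hardDist n ρ M δ η

lemma ae_hardDist {P Q : (Fin 2 → ℝ≥0) → Prop} (hP : ∀ᵐ x ∂(bigDist ρ M δ), P x)
    (hQ : ∀ᵐ x ∂(smallDist δ η), Q x) :
    ∀ᵐ w ∂(Measure.pi (hardDist n ρ M δ η)), P (w 0) ∧ ∀ s : Fin n, Q (w s.succ) := by
  refine Filter.Eventually.and ?_ (ae_all_iff.2 fun s => ?_)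
  · exact (Measure.tendsto_eval_ae_ae (μ := hardDist n ρ M δ η) (i := 0)).eventually hP
  · exact (Measure.tendsto_eval_ae_ae (μ := hardDist n ρ M δ η) (i := s.succ)).eventually hQ

lemma integrable_comp_response (p : Fin 2 → ℝ≥0) (F : (Fin n → Response) → ℝ) :
    Integrable (fun y : Fin n → Fin 2 → ℝ≥0 => F fun s => response p (y s))
      (Measure.pi fun _ => smallDist δ η) := by
  have hK : Measurable fun (y : Fin n → Fin 2 → ℝ≥0) (s : Fin n) => response p (y s) :=
    measurable_pi_lambda _ fun s => (measurable_response p).comp (measurable_pi_apply s)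
  have := Measure.isProbabilityMeasure_map (μ := Measure.pi fun _ : Fin n => smallDist δ η)
    hK.aemeasurable
  exact (Integrable.of_finite (f := F)).comp_measurable hK

lemma integral_comp_response (p : Fin 2 → ℝ≥0) (F : (Fin n → Response) → ℝ) :
    ∫ y : Fin n → Fin 2 → ℝ≥0, F (fun s => response p (y s)) ∂(Measure.pi fun _ => smallDist δ η) =
      ∫ κ, F κ ∂(Measure.pi fun _ => (smallDist δ η).map (response p)) := by
  have hr := measurable_response p
  have : IsProbabilityMeasure ((smallDist δ η).map (response p)) :=
    Measure.isProbabilityMeasure_map hr.aemeasurable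
  have hK : Measurable fun (y : Fin n → Fin 2 → ℝ≥0) (s : Fin n) => response p (y s) :=
    measurable_pi_lambda _ fun s => hr.comp (measurable_pi_apply s)
  rw [← Measure.pi_map_pi (fun _ => hr.aemeasurable), integral_map hK.aemeasurable .of_discrete]

lemma integrable_bigEvent (M : ℝ≥0) (j : Fin 2) :
    Integrable ((bigEvent M j).indicator (1 : (Fin 2 → ℝ≥0) → ℝ)) (bigDist ρ M δ) :=
  (integrable_const (1 : ℝ)).indicator (measurableSet_bigEvent M j)

lemma BigTypes.cases_event {x : Fin 2 → ℝ≥0} (hM : δ < M - 1) (h : BigTypes M δ x) :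
    (∃ j, x ∈ bigEvent M j ∧ x j ≤ M ∧ ∀ i, i ≠ j → x i = 0 ∧ x ∉ bigEvent M i) ∨
      ((∀ j, x ∉ bigEvent M j) ∧ ∑ j, (x j : ℝ) ≤ δ) := by
  have h0 : ¬ M - 1 ≤ 0 := not_le.2 (zero_le.trans_lt hM)
  rcases h with ⟨h1, h2, h3⟩ | ⟨h1, h2, h3⟩ | ⟨h1, h2⟩
  · refine Or.inl ⟨0, h1, h2, fun i hi => ?_⟩
    obtain rfl : i = 1 := by omega
    exact ⟨h3, fun h => h0 (h3 ▸ h)⟩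
  · refine Or.inl ⟨1, h1, h2, fun i hi => ?_⟩
    obtain rfl : i = 0 := by omega
    exact ⟨h3, fun h => h0 (h3 ▸ h)⟩
  · refine Or.inr ⟨Fin.forall_fin_two.2 ⟨fun h => (le_trans h h1).not_gt hM, fun h => h0 (h2 ▸ h)⟩, ?_⟩
    rw [Fin.sum_univ_two, h2, NNReal.coe_zero, add_zero]
    exact h1

/-- The adversary's bounds depend on the responses of the small buyers, which are independent of the
big buyer, so the expectations factor. The error terms are the mixed profiles, the value `δ` of a
negligible big buyer, and the small sales made when the big buyer is present. -/
lemma welfare_hardDist_le (hk : 1 ≤ k) {θ c τ : ℝ} (hc : 0 ≤ c) (hck : c ≤ k)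
    (hθ : θ * (k + c) = k) (hδ : 0 < δ) (hη : 0 < η) (hρ : 2 * ρ ≤ 1) (hM : δ < M - 1)
    (hρM : (ρ * M : ℝ) = c) (hτ : ∀ α β : ℝ, 0 ≤ α → 0 ≤ β → α + β ≤ 1 →
      trinomialExp α β (payoff k θ) n 0 0 ≤ τ) (p : Fin 2 → ℝ≥0) :
    ∫ w, (worstOrderWelfare (fun _ => k) (fun i => unitDemand (w i)) p : ℝ)
        ∂(Measure.pi (hardDist n ρ M δ η)) ≤
      (1 + δ + η) * ((2 * k + 2 * c) * τ + 2 * c * (n * (2 * η / δ))) + δ +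
        4 * k * ρ * (1 + δ + η) := by
  classical
  set e : ℝ := 1 + δ + η with he
  have he1 : 1 ≤ e := by
    have := δ.2
    have := η.2
    change (1 : ℝ) ≤ 1 + δ.1 + η.1
    linarith
  have he0 : 0 ≤ e := zero_le_one.trans he1
  choose H₀ H hH₀ hH hineq hbound using fun κ : Fin n → Response =>
    exists_adversary_bounds hk hc hck hθ κ
  set ν := (smallDist δ η).map (response p) with hν
  have : IsProbabilityMeasure ν :=
    Measure.isProbabilityMeasure_map (measurable_response p).aemeasurable
  set f : Fin 2 → (Fin 2 → ℝ≥0) → ℝ := fun j => (bigEvent M j).indicator 1 with hf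
  set g₀ : (Fin n → Fin 2 → ℝ≥0) → ℝ := fun y => e * H₀ (fun s => response p (y s)) + δ with hg₀
  set g : Fin 2 → (Fin n → Fin 2 → ℝ≥0) → ℝ :=
    fun j y => 2 * k * e + M * H (fun s => response p (y s)) j with hg
  have hg₀i : Integrable g₀ (Measure.pi fun _ => smallDist δ η) :=
    integrable_comp_response p fun κ => e * H₀ κ + δ
  have hgi : ∀ j, Integrable (g j) (Measure.pi fun _ => smallDist δ η) := fun j =>
    integrable_comp_response p fun κ => 2 * k * e + M * H κ j
  have hfi : ∀ j, Integrable (f j) (bigDist ρ M δ) := fun j => integrable_bigEvent M j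
  have hI₀ := integrable_head_mul_tail (hardDist n ρ M δ η) (integrable_const (1 : ℝ)) hg₀i
  have hI := fun j => integrable_head_mul_tail (hardDist n ρ M δ η) (hfi j) (hgi j)
  have hdom : ∀ᵐ w ∂(Measure.pi (hardDist n ρ M δ η)),
      (worstOrderWelfare (fun _ => k) (fun i => unitDemand (w i)) p : ℝ) ≤
        1 * g₀ (Fin.tail w) + f 0 (w 0) * g 0 (Fin.tail w) + f 1 (w 0) * g 1 (Fin.tail w) := by
    filter_upwards [ae_hardDist (n := n) (ae_bigTypes ρ M δ)
      ((ae_generic hδ hη p).and (ae_smallDist_bounds δ η))] with w hw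
    obtain ⟨hbig, hsmall⟩ := hw
    obtain ⟨hb1, hb2⟩ := hbound (fun s => response p (w s.succ)) p w e he0
      (fun s => responds_response (hsmall s).1) fun s j => ((hsmall s).2 j).2
    have hg₀nn : 0 ≤ g₀ (Fin.tail w) := add_nonneg (mul_nonneg he0 (hH₀ _)) δ.2
    have hMnn : (0 : ℝ) ≤ M := M.2
    rcases hbig.cases_event hM with ⟨j, hj, hjM, hne⟩ | ⟨hnone, hsum⟩
    · have h1 := hb2 j fun i hi => (hne i hi).1
      have h2 : (w 0 j : ℝ) * H (fun s => response p (w s.succ)) j ≤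
          M * H (fun s => response p (w s.succ)) j :=
        mul_le_mul_of_nonneg_right (NNReal.coe_le_coe.2 hjM) (hH _ j)
      have h3 : f j (w 0) = 1 := Set.indicator_of_mem hj _
      have h4 : ∀ i, i ≠ j → f i (w 0) = 0 := fun i hi => Set.indicator_of_notMem (hne i hi).2 _
      have h5 : f 0 (w 0) * g 0 (Fin.tail w) + f 1 (w 0) * g 1 (Fin.tail w) = g j (Fin.tail w) := by
        rw [← Fin.sum_univ_two fun i => f i (w 0) * g i (Fin.tail w),
          Finset.sum_eq_single j (fun i _ hi => by rw [h4 i hi, zero_mul]) (by simp), h3, one_mul]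
      have h6 : g j (Fin.tail w) = 2 * k * e + M * H (fun s => response p (w s.succ)) j := rfl
      linarith
    · have h4 : ∀ i, f i (w 0) = 0 := fun i => Set.indicator_of_notMem (hnone i) _
      have h6 : g₀ (Fin.tail w) = e * H₀ (fun s => response p (w s.succ)) + δ := rfl
      rw [h4, h4, zero_mul, zero_mul, h6]
      linarith
  -- Only the dominating function has to be integrable, so no measurability of the worst-order
  -- welfare is needed.
  refine (integral_mono_of_nonneg (.of_forall fun w => NNReal.coe_nonneg _)
    ((hI₀.add (hI 0)).add (hI 1)) hdom).trans ?_
  have hfint : ∀ j, ∫ x, f j x ∂(hardDist n ρ M δ η 0) = ρ := fun j => by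
    rw [hf]
    exact (integral_indicator_one (measurableSet_bigEvent M j)).trans
      (bigDist_real_bigEvent hρ hM j)
  have hg₀int : ∫ y, g₀ y ∂(Measure.pi fun _ => smallDist δ η) =
      e * (∫ κ, H₀ κ ∂(Measure.pi fun _ => ν)) + δ := by
    rw [hg₀, integral_comp_response p fun κ => e * H₀ κ + δ]
    simp only [← hν]
    rw [integral_add .of_finite .of_finite, integral_const_mul]
    simp
  have hgint : ∀ j, ∫ y, g j y ∂(Measure.pi fun _ => smallDist δ η) =
      2 * k * e + M * ∫ κ, H κ j ∂(Measure.pi fun _ => ν) := fun j => by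
    rw [hg]
    dsimp only
    rw [integral_comp_response p fun κ => 2 * k * e + M * H κ j]
    simp only [← hν]
    rw [integral_add .of_finite .of_finite, integral_const_mul (M : ℝ)]
    simp
  have h01 : Integrable (fun w : Fin (n + 1) → Fin 2 → ℝ≥0 =>
      1 * g₀ (Fin.tail w) + f 0 (w 0) * g 0 (Fin.tail w)) (Measure.pi (hardDist n ρ M δ η)) :=
    hI₀.add (hI 0)
  change ∫ w : Fin (n + 1) → Fin 2 → ℝ≥0, (1 * g₀ (Fin.tail w) + f 0 (w 0) * g 0 (Fin.tail w)) +
    f 1 (w 0) * g 1 (Fin.tail w) ∂(Measure.pi (hardDist n ρ M δ η)) ≤ _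
  rw [integral_add h01 (hI 1), integral_add hI₀ (hI 0),
    integral_head_mul_tail _ (fun _ => 1) g₀, integral_head_mul_tail _ (f 0) (g 0),
    integral_head_mul_tail _ (f 1) (g 1), tail_hardDist, hfint, hfint, hg₀int, hgint, hgint]
  set E₀ := ∫ κ, H₀ κ ∂(Measure.pi fun _ : Fin n => ν)
  set E : Fin 2 → ℝ := fun j => ∫ κ, H κ j ∂(Measure.pi fun _ : Fin n => ν) with hE
  have hEnn : ∀ j, 0 ≤ E j := fun j => integral_nonneg fun κ => hH κ j
  obtain ⟨A, hA, hAle⟩ := exists_small_response_set (η := η) hδ p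
  have hmixed := (integral_mixed_le (n := n) ν (hA n)).trans
    (mul_le_mul_of_nonneg_left hAle (Nat.cast_nonneg n))
  have hpay : ∫ κ, payoff k θ (prefCount κ 0) (prefCount κ 1) ∂(Measure.pi fun _ : Fin n => ν) ≤
      τ := by
    have h1 := integral_counts_eq ν (payoff k θ) n 0 0
    simp only [zero_add] at h1
    rw [h1]
    refine hτ _ _ measureReal_nonneg measureReal_nonneg ?_
    rw [← measureReal_union _ .of_discrete]
    · exact measureReal_le_one
    · rw [Set.disjoint_left]
      rintro r ⟨b, rfl⟩ ⟨b', hb'⟩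
      simp at hb'
  have hkey : E₀ + c * (E 0 + E 1) ≤ (2 * k + 2 * c) * τ + 2 * c * (n * (2 * η / δ)) := by
    have h1 : E₀ + c * (E 0 + E 1) =
        ∫ κ, (H₀ κ + c * (H κ 0 + H κ 1)) ∂(Measure.pi fun _ : Fin n => ν) := by
      rw [integral_add .of_finite .of_finite, integral_const_mul, integral_add .of_finite .of_finite]
    rw [h1]
    refine (integral_mono .of_finite .of_finite hineq).trans ?_
    rw [integral_add .of_finite .of_finite, integral_const_mul, integral_const_mul]
    have hk0 : (0 : ℝ) ≤ k := Nat.cast_nonneg k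
    gcongr
  -- As `e ≥ 1`, the big buyer's share can be scaled up together with the small sales, so that
  -- `hkey` applies to both at once.
  have hsum : c * (E 0 + E 1) ≤ e * (c * (E 0 + E 1)) :=
    le_mul_of_one_le_left (mul_nonneg hc (add_nonneg (hEnn 0) (hEnn 1))) he1
  have hfin := mul_le_mul_of_nonneg_left hkey he0
  have h1 : ∫ _, (1 : ℝ) ∂(hardDist n ρ M δ η 0) = 1 := by simp
  rw [h1]
  change 1 * (e * E₀ + δ) + ρ * (2 * k * e + M * E 0) + ρ * (2 * k * e + M * E 1) ≤ _
  have h2 : 1 * (e * E₀ + δ) + ρ * (2 * k * e + M * E 0) + ρ * (2 * k * e + M * E 1) =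
      e * E₀ + δ + 4 * k * ρ * e + (ρ * M) * (E 0 + E 1) := by ring
  rw [h2, hρM]
  linarith

/-! ### The prophet -/

/-- An injective assignment of buyers to copies yields a feasible allocation, worth at least the sum
of the assigned values. -/
lemma sum_le_hindsightOpt {N : ℕ} (w : Fin N → Fin 2 → ℝ≥0) {g : Fin 2 × Fin k → Fin N}
    (hg : Function.Injective g) :
    ∑ x, w (g x) x.1 ≤ hindsightOpt (fun _ => k) fun i => unitDemand (w i) := by
  classical
  set A : Fin N → Finset (Fin 2) := fun i => Finset.univ.filter fun j => ∃ t, g (j, t) = i with hA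
  have hfeas : ∀ j, (Finset.univ.filter fun i => j ∈ A i).card ≤ k := fun j => by
    have : (Finset.univ.filter fun i => j ∈ A i) ⊆ Finset.univ.image fun t => g (j, t) := fun i hi => by
      simpa [hA] using hi
    exact (Finset.card_le_card this).trans (Finset.card_image_le.trans (by simp))
  calc ∑ x, w (g x) x.1 ≤ ∑ x, unitDemand (w (g x)) (A (g x)) :=
        Finset.sum_le_sum fun x _ => Finset.le_sup (f := w (g x)) (by simp [hA])
    _ = ∑ i ∈ Finset.univ.image g, unitDemand (w i) (A i) :=
        (Finset.sum_image (f := fun i => unitDemand (w i) (A i)) fun x _ y _ h => hg h).symm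
    _ ≤ ∑ i, unitDemand (w i) (A i) := Finset.sum_le_sum_of_subset (Finset.subset_univ _)
    _ ≤ _ := Finset.le_sup (f := fun A : Fin N → Finset (Fin 2) => ∑ i, unitDemand (w i) (A i))
        (Finset.mem_filter.2 ⟨Finset.mem_univ _, hfeas⟩)

lemma hindsightOpt_ge (hk : 1 ≤ k) (hn : 2 * k ≤ n) {w : Fin (n + 1) → Fin 2 → ℝ≥0}
    (hw : ∀ (s : Fin n) j, (1 : ℝ) ≤ w s.succ j) :
    (2 * k : ℝ) ≤ hindsightOpt (fun _ => k) (fun i => unitDemand (w i)) ∧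
    ∀ j, 2 * k - 1 + (w 0 j : ℝ) ≤ hindsightOpt (fun _ => k) (fun i => unitDemand (w i)) := by
  obtain ⟨g⟩ : Nonempty (Fin 2 × Fin k ↪ Fin n) :=
    Function.Embedding.nonempty_of_card_le (by simpa using hn)
  constructor
  · have h := sum_le_hindsightOpt w (g := fun x => (g x).succ)
      ((Fin.succ_injective n).comp g.injective)
    refine le_trans ?_ (NNReal.coe_le_coe.2 h)
    rw [NNReal.coe_sum]
    refine le_trans ?_ (Finset.sum_le_sum fun x _ => hw (g x) x.1)
    simp
  · intro j
    set x₀ : Fin 2 × Fin k := (j, ⟨0, hk⟩) with hx₀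
    have hinj : Function.Injective fun x => if x = x₀ then (0 : Fin (n + 1)) else (g x).succ := by
      intro x y hxy
      dsimp only at hxy
      split_ifs at hxy with h1 h2 h2
      · exact h1.trans h2.symm
      · exact absurd hxy.symm (Fin.succ_ne_zero _)
      · exact absurd hxy (Fin.succ_ne_zero _)
      · exact g.injective (Fin.succ_injective n hxy)
    have h := sum_le_hindsightOpt w hinj
    refine le_trans ?_ (NNReal.coe_le_coe.2 h)
    rw [NNReal.coe_sum, ← Finset.add_sum_erase _ _ (Finset.mem_univ x₀), if_pos rfl]
    have h1 : (2 * k - 1 : ℝ) ≤ ∑ x ∈ Finset.univ.erase x₀,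
        (w (if x = x₀ then (0 : Fin (n + 1)) else (g x).succ) x.1 : ℝ) := by
      refine le_trans ?_ (Finset.sum_le_sum (f := fun _ => (1 : ℝ)) fun x hx => ?_)
      · rw [Finset.sum_const, Finset.card_erase_of_mem (Finset.mem_univ _)]
        simp only [Finset.card_univ, Fintype.card_prod, Fintype.card_fin, nsmul_eq_mul, mul_one]
        rw [Nat.cast_sub (by omega)]
        push_cast
        exact le_rfl
      · rw [if_neg (Finset.ne_of_mem_erase hx)]
        exact hw _ _
    linarith

lemma measurable_finset_sup {α ι : Type*} [MeasurableSpace α] (s : Finset ι) {F : ι → α → ℝ≥0}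
    (hF : ∀ i, Measurable (F i)) : Measurable fun a => s.sup fun i => F i a := by
  classical
  induction s using Finset.induction_on with
  | empty => simp
  | insert i s _ ih =>
    simp only [Finset.sup_insert]
    exact (hF i).sup ih

lemma integrable_hindsightOpt {N : ℕ} (μ : Fin N → Measure (Fin 2 → ℝ≥0))
    [∀ i, IsProbabilityMeasure (μ i)]
    (hμ : ∀ i j, Integrable (fun w : Fin 2 → ℝ≥0 => (w j : ℝ)) (μ i)) (K : Fin 2 → ℕ) :
    Integrable (fun w : Fin N → Fin 2 → ℝ≥0 => (hindsightOpt K (fun i => unitDemand (w i)) : ℝ))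
      (Measure.pi μ) := by
  have hbd : Integrable (fun w : Fin N → Fin 2 → ℝ≥0 => ∑ i, ∑ j, (w i j : ℝ)) (Measure.pi μ) :=
    integrable_finsetSum _ fun i _ => integrable_finsetSum _ fun j _ =>
      (measurePreserving_eval μ i).integrable_comp_of_integrable (hμ i j)
  have hunit : ∀ (i : Fin N) (S : Finset (Fin 2)),
      Measurable fun w : Fin N → Fin 2 → ℝ≥0 => unitDemand (w i) S := fun i S => by
    unfold unitDemand
    exact measurable_finset_sup S fun j => by fun_prop
  have hmeas : Measurable fun w : Fin N → Fin 2 → ℝ≥0 =>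
      hindsightOpt K fun i => unitDemand (w i) := by
    unfold hindsightOpt
    exact measurable_finset_sup _ fun A => Finset.measurable_fun_sum _ fun i _ => hunit i (A i)
  refine hbd.mono' hmeas.coe_nnreal_real.aestronglyMeasurable (.of_forall fun w => ?_)
  rw [NNReal.norm_eq]
  have : hindsightOpt K (fun i => unitDemand (w i)) ≤ ∑ i, ∑ j, w i j :=
    Finset.sup_le fun A _ => Finset.sum_le_sum fun i _ => (unitDemand_le_sum (w i) (A i)).trans
      (Finset.sum_le_sum_of_subset (Finset.subset_univ _))
  exact_mod_cast this

/-- A big buyer is worth at least `M - 1` and displaces one small buyer, counted as `1`; this is a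
net gain of `M - 2`, with probability `ρ` for each item. -/
lemma le_prophet_hardDist (hk : 1 ≤ k) (hn : 2 * k ≤ n) (hρ : 2 * ρ ≤ 1) (hM : δ < M - 1) :
    2 * k + 2 * (ρ * (M - 2) : ℝ) ≤
      ∫ w, (hindsightOpt (fun _ => k) (fun i => unitDemand (w i)) : ℝ)
        ∂(Measure.pi (hardDist n ρ M δ η)) := by
  have hM1 : (1 : ℝ≥0) ≤ M := by
    by_contra h
    rw [tsub_eq_zero_of_le (not_le.1 h).le] at hM
    exact (not_lt_zero hM)
  set f : Fin 2 → (Fin 2 → ℝ≥0) → ℝ := fun j => (bigEvent M j).indicator 1 with hf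
  have hconst : Integrable (fun _ : Fin n → Fin 2 → ℝ≥0 => (M - 2 : ℝ))
    (Measure.pi fun _ => smallDist δ η) := integrable_const _
  have hI := fun j => integrable_head_mul_tail (hardDist n ρ M δ η)
    (integrable_bigEvent (δ := δ) (ρ := ρ) M j) hconst
  have hdom : ∀ᵐ w ∂(Measure.pi (hardDist n ρ M δ η)),
      2 * k + f 0 (w 0) * (M - 2) + f 1 (w 0) * (M - 2) ≤
        (hindsightOpt (fun _ => k) (fun i => unitDemand (w i)) : ℝ) := by
    filter_upwards [ae_hardDist (n := n) (ae_bigTypes ρ M δ) (ae_smallDist_bounds δ η)] with w hw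
    obtain ⟨hbig, hsmall⟩ := hw
    obtain ⟨h1, h2⟩ := hindsightOpt_ge hk hn fun s j => (hsmall s j).1
    rcases hbig.cases_event hM with ⟨j, hj, hjM, hne⟩ | ⟨hnone, hsum⟩
    · have h3 : f j (w 0) = 1 := Set.indicator_of_mem hj _
      have h4 : ∀ i, i ≠ j → f i (w 0) = 0 := fun i hi => Set.indicator_of_notMem (hne i hi).2 _
      have h5 : f 0 (w 0) * (M - 2 : ℝ) + f 1 (w 0) * (M - 2) = M - 2 := by
        rw [← Fin.sum_univ_two fun i => f i (w 0) * (M - 2 : ℝ),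
          Finset.sum_eq_single j (fun i _ hi => by rw [h4 i hi, zero_mul]) (by simp), h3, one_mul]
      have h6 : (M : ℝ) - 1 ≤ w 0 j := by
        have := NNReal.coe_le_coe.2 (show M - 1 ≤ w 0 j from hj)
        rwa [NNReal.coe_sub hM1, NNReal.coe_one] at this
      linarith [h2 j]
    · have h4 : ∀ i, f i (w 0) = 0 := fun i => Set.indicator_of_notMem (hnone i) _
      rw [h4, h4]
      linarith
  have hfint : ∀ j, ∫ x, f j x ∂(hardDist n ρ M δ η 0) = ρ := fun j => by
    rw [hf]
    exact (integral_indicator_one (measurableSet_bigEvent M j)).trans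
      (bigDist_real_bigEvent hρ hM j)
  have h01 : Integrable (fun w : Fin (n + 1) → Fin 2 → ℝ≥0 =>
      2 * k + f 0 (w 0) * (M - 2 : ℝ)) (Measure.pi (hardDist n ρ M δ η)) :=
    (integrable_const _).add (hI 0)
  refine le_trans (le_of_eq ?_) (integral_mono_ae (h01.add (hI 1))
    (integrable_hindsightOpt _ (integrable_hardDist n ρ M δ η) _) hdom)
  have h1 : ∀ j, ∫ w, f j (w 0) * (M - 2 : ℝ) ∂(Measure.pi (hardDist n ρ M δ η)) =
      ρ * (M - 2) := fun j => by
    rw [integral_head_mul_tail (hardDist n ρ M δ η) (f j)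
      (fun _ : Fin n → Fin 2 → ℝ≥0 => (M - 2 : ℝ)), hfint, tail_hardDist]
    simp
  change _ = ∫ w : Fin (n + 1) → Fin 2 → ℝ≥0,
    (2 * k + f 0 (w 0) * (M - 2 : ℝ)) + f 1 (w 0) * (M - 2 : ℝ) ∂(Measure.pi (hardDist n ρ M δ η))
  rw [integral_add h01 (hI 1), integral_add (integrable_const _) (hI 0)]
  erw [h1, h1]
  simp
  ring

end HardInstanceBounds

/-! ### Choice of the parameters. -/

lemma mixHat_zero_nonneg (k : ℕ) {θ : ℝ} (h0 : 0 ≤ θ) (h1 : θ ≤ 1) : 0 ≤ mixHat k θ 0 := by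
  have h2 : 0 ≤ muHat k 0 := div_nonneg (integral_nonneg fun i => Nat.cast_nonneg _) (by positivity)
  have h3 : 0 ≤ deltaHat k 0 := Finset.sum_nonneg fun i _ =>
    mul_nonneg measureReal_nonneg measureReal_nonneg
  exact add_nonneg (mul_nonneg h0 h2) (mul_nonneg (sub_nonneg.2 h1) h3)

/-- Against a mixture of `muHat` and `deltaHat` that puts at least half of the weight on `muHat`,
no static pricing beats the largest value of the mixture. -/
lemma exists_hard_instance {k : ℕ} (hk : 1 ≤ k) {θ T : ℝ} (hθ : 1 / 2 ≤ θ) (hθ1 : θ < 1)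
    (hT : ∀ x, 0 ≤ x → mixHat k θ x ≤ T) {ε : ℝ} (hε : 0 < ε) :
    ∃ I : Instance 2, (∀ j, I.supply j = k) ∧ 0 < I.prophet ∧
      ∀ p : Fin 2 → ℝ≥0, I.welfare p / I.prophet ≤ T + ε := by
  have hk1 : (1 : ℝ) ≤ k := by exact_mod_cast hk
  have hθ0 : 0 < θ := by linarith
  have hT0 : 0 ≤ T := (mixHat_zero_nonneg k hθ0.le hθ1.le).trans (hT 0 le_rfl)
  -- Chosen so that small and big buyers contribute to the prophet's reward in the ratio `θ : (1 -
  -- θ)`; `θ ≥ 1 / 2` becomes `c ≤ k`.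
  obtain ⟨c, hc⟩ : ∃ c : ℝ, c = k * (1 - θ) / θ := ⟨_, rfl⟩
  have hc0 : 0 < c := by
    rw [hc]
    exact div_pos (mul_pos (by linarith) (by linarith)) hθ0
  have hck : c ≤ k := by
    rw [hc, div_le_iff₀ hθ0]
    nlinarith
  have hθc : θ * (k + c) = k := by
    rw [hc]
    field_simp
    ring
  obtain ⟨N, hN⟩ := exists_trinomialExp_payoff_le hk hθ1.le hT (half_pos hε)
  obtain ⟨n, hnN, hn⟩ : ∃ n, N ≤ n ∧ 2 * k ≤ n := ⟨max N (2 * k), le_max_left _ _, le_max_right _ _⟩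
  -- After `n` is fixed, one small number sets all the scales: `ρ = δ = d`, `M = c / d` and `η = d ^
  -- 2 / (n + 1)`. At `d = 0` the last inequality reads `(2 * k + 2 * c) * (T + ε / 2) < (T + ε) *
  -- (2 * k + 2 * c)`, so by continuity it persists for small `d`.
  obtain ⟨d, hd0, hd1, hd2, hd3⟩ : ∃ d : ℝ, 0 < d ∧ 2 * d < 1 ∧ d * (d + 1) < c ∧
      (1 + d + d * (d / (n + 1))) * ((2 * k + 2 * c) * (T + ε / 2) +
        2 * c * (n * (2 * (d / (n + 1))))) + d + 4 * k * d * (1 + d + d * (d / (n + 1))) <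
      (T + ε) * (2 * k + 2 * c - 4 * d) := by
    have e1 : ∀ᶠ d : ℝ in nhds 0, 2 * d < 1 :=
      ContinuousAt.eventually_lt (by fun_prop) (by fun_prop) (by norm_num)
    have e2 : ∀ᶠ d : ℝ in nhds 0, d * (d + 1) < c :=
      ContinuousAt.eventually_lt (by fun_prop) (by fun_prop) (by simpa using hc0)
    have e3 : ∀ᶠ d : ℝ in nhds 0, (1 + d + d * (d / (n + 1))) * ((2 * k + 2 * c) * (T + ε / 2) +
        2 * c * (n * (2 * (d / (n + 1))))) + d + 4 * k * d * (1 + d + d * (d / (n + 1))) <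
        (T + ε) * (2 * k + 2 * c - 4 * d) := by
      refine ContinuousAt.eventually_lt (by fun_prop) (by fun_prop) ?_
      simp only [zero_div, mul_zero, add_zero, sub_zero, one_mul, zero_mul]
      nlinarith
    obtain ⟨d, hd, h1, h2, h3⟩ := ((eventually_mem_nhdsWithin (a := (0 : ℝ)) (s := Set.Ioi 0)).and
      ((e1.and (e2.and e3)).filter_mono nhdsWithin_le_nhds)).exists
    exact ⟨d, hd, h1, h2, h3⟩
  set δ : ℝ≥0 := ⟨d, hd0.le⟩ with hδ
  set η : ℝ≥0 := ⟨d * (d / (n + 1)), by positivity⟩ with hη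
  set M : ℝ≥0 := ⟨c / d, by positivity⟩ with hM
  have hδd : (δ : ℝ) = d := rfl
  have hηd : (η : ℝ) = d * (d / (n + 1)) := rfl
  have hMd : (M : ℝ) = c / d := rfl
  have hδ0 : 0 < δ := hd0
  have hη0 : 0 < η := by
    rw [← NNReal.coe_pos, hηd]
    positivity
  have hM2 : δ + 1 < M := by
    rw [← NNReal.coe_lt_coe, NNReal.coe_add, hδd, hMd, NNReal.coe_one, lt_div_iff₀ hd0]
    linarith
  have hM3 : δ < M - 1 := lt_tsub_iff_right.2 hM2
  have hM1 : 1 ≤ M := le_add_self.trans hM2.le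
  have hρ : 2 * δ ≤ 1 := by
    rw [← NNReal.coe_le_coe]
    push_cast
    rw [hδd]
    exact hd1.le
  have hρM : (δ * M : ℝ) = c := by
    rw [hδd, hMd]
    field_simp
  have hprophet := le_prophet_hardDist (η := η) hk hn hρ hM3
  have hwelfare := welfare_hardDist_le (n := n) hk hc0.le hck hθc hδ0 hη0 hρ hM3 hρM (hN n hnN)
  set I := hardInstance n k δ M δ η hM1 hδ0 with hI
  have hp1 : 2 * k + 2 * c - 4 * d ≤ I.prophet := by
    refine le_trans (le_of_eq ?_) hprophet
    rw [mul_sub, hρM, hδd]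
    ring
  have hp0 : 0 < I.prophet := by linarith
  refine ⟨I, fun _ => rfl, hp0, fun p => ?_⟩
  rw [div_le_iff₀ hp0]
  have h1 : 2 * (η : ℝ) / δ = 2 * (d / (n + 1)) := by
    rw [hηd, hδd]
    field_simp
  have h2 := hwelfare p
  rw [h1, hηd, hδd] at h2
  calc I.welfare p ≤ _ := h2
    _ ≤ (T + ε) * (2 * k + 2 * c - 4 * d) := hd3.le
    _ ≤ (T + ε) * I.prophet := by gcongr

end ItemPricing

end

theorem mainTheorem6 (k : ℕ) (hk : 1 ≤ k) :
    (∃! x : ℝ, ItemPricing.IsCrossing k x) ∧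
    (2 ≤ k → ∃! x : ℝ, ItemPricing.IsStationary k x) ∧
    (k = 1 → ∀ x : ℝ, 0 ≤ x → ItemPricing.IsStationary k x) ∧
    ∀ xCross xStat : ℝ, ItemPricing.IsCrossing k xCross → ItemPricing.IsStationary k xStat →
      ∀ ε : ℝ, 0 < ε →
        ∃ I : ItemPricing.Instance 2, (∀ j, I.supply j = k) ∧ 0 < I.prophet ∧
          ∀ p : Fin 2 → NNReal,
            I.welfare p / I.prophet ≤ ItemPricing.tauHat k xCross xStat + ε := by
  refine ⟨ItemPricing.existsUnique_isCrossing hk, ItemPricing.existsUnique_isStationary, ?_, ?_⟩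
  · rintro rfl x hx
    exact ItemPricing.isStationary_one hx
  · intro xCross xStat hc hs ε hε
    obtain ⟨θ, hθ, hθ1, h⟩ := ItemPricing.exists_weight hk hc hs
    exact ItemPricing.exists_hard_instance hk hθ hθ1 h hε
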